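/- Let $m,n$ be positive integers with $m<n$, let $a,b,c,d,q$ be positive real numbers, and let $1\le s_1<s_2<\dots<s_m\le n$ be integers. Let $AR_{m,n}$ be the Aztec rectangle graph consisting of $m$ rows and $n$ columns of diamonds ($4$-cycles with a top, bottom, left and right corner), in which the top corner of each diamond is the bottom corner of the diamond directly above it, and the right corner of each diamond is the left corner of the diamond directly to its right. The diamond in row $i$ (from bottom to top) and column $j$ (from left to right) has edge weights $a,\ b,\ dq^{i+j-2},\ cq^{i+j-2}$, in clockwise order starting from its northwest edge. Remove all $n$ bottommost vertices (the bottom corners of the diamonds in row $1$) except the $s_1$-st, $s_2$-nd, $\dots$, $s_m$-th ones, counted from left to right. Then the matching generating function of the resulting weighted graph, that is, the sum over its perfect matchings of the product of the weights of the edges in the matching, equals, for $q\ne 1$, $$q^{\frac{(m-1)m(m+1)}{3}+\sum_{i=1}^m(s_i-i)}\;a^{\sum_{i=1}^m(s_i-i)}\;b^{m(n-m)-\sum_{i=1}^m(s_i-i)}\;\prod_{k=1}^m\left(adq^{k-1}+bc\right)^{m-k+1}\prod_{1\le i<j\le m}\frac{q^{s_j}-q^{s_i}}{q^j-q^i}.$$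 For $q=1$ it equals the limit of this expression as $q\to1$, namely $$a^{\sum_{i=1}^m(s_i-i)}\;b^{m(n-m)-\sum_{i=1}^m(s_i-i)}\;(ad+bc)^{m(m+1)/2}\prod_{1\le i<j\le m}\frac{s_j-s_i}{j-i}.$$ -/

import Mathlib

namespace AztecRectangle

/-- The matching generating function of a finite graph `G` with edge weights `w`: the sum, over all
perfect matchings of `G`, of the product of the weights of the edges of the matching. -/
noncomputable def matchingGF {V : Type*} [Fintype V] (G : SimpleGraph V) (w : Sym2 V → ℝ) : ℝ :=
  open scoped Classical in
  ∑ M : {M : G.Subgraph // M.IsPerfectMatching}, ∏ e ∈ M.1.edgeSet.toFinset, w e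

/-- The vertices of the Aztec rectangle graph with `m` rows and `n` columns of diamonds (4-cycles).
Rows (from bottom to top) and columns (from left to right) are numbered from `0` here.
The diamond in row `i : Fin m` and column `j : Fin n` has
* bottom corner `Sum.inl (i, j)` and top corner `Sum.inl (i + 1, j)`,
* left corner `Sum.inr (i, j)` and right corner `Sum.inr (i, j + 1)`.
So vertically adjacent diamonds share a top/bottom corner, and horizontally adjacent ones
share a left/right corner. The bottommost vertices are the `Sum.inl (0, j)`. -/
abbrev Vertex (m n : ℕ) : Type := (Fin (m + 1) × Fin n) ⊕ (Fin m × Fin (n + 1))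

/-- `p` is the top or bottom corner, and `r` the left or right corner, of a common diamond. -/
def SameDiamond {m n : ℕ} (p : Fin (m + 1) × Fin n) (r : Fin m × Fin (n + 1)) : Prop :=
  ((p.1 : ℕ) = r.1 ∨ (p.1 : ℕ) = r.1 + 1) ∧ ((r.2 : ℕ) = p.2 ∨ (r.2 : ℕ) = p.2 + 1)

/-- The Aztec rectangle graph: its edges are the sides of the diamonds. -/
def graph (m n : ℕ) : SimpleGraph (Vertex m n) where
  Adj
    | Sum.inl p, Sum.inr r => SameDiamond p r
    | Sum.inr r, Sum.inl p => SameDiamond p r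
    | _, _ => False
  symm := ⟨by rintro (p | r) (p' | r') h <;> exact h⟩
  loopless := ⟨by rintro (p | r) h <;> exact h⟩

/-- The weight of the side joining a top/bottom corner `p` and a left/right corner `r` of the
diamond in the (0-based) row `i = r.1` and column `j = p.2`: the sides northwest, northeast,
southeast, southwest have weights `a`, `b`, `d q^(i+j)`, `c q^(i+j)`. The corner `p` is the top one
iff `p.1 = i + 1`, and `r` is the left one iff `r.2 = j`. -/
def sideWeight (a b c d q : ℝ) {m n : ℕ} (p : Fin (m + 1) × Fin n) (r : Fin m × Fin (n + 1)) : ℝ :=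
  if (p.1 : ℕ) = r.1 + 1 then
    if (r.2 : ℕ) = p.2 then a else b
  else
    if (r.2 : ℕ) = p.2 then c * q ^ ((r.1 : ℕ) + p.2) else d * q ^ ((r.1 : ℕ) + p.2)

/-- The edge weights of the Aztec rectangle graph (the value `0` on non-edges is never used). -/
def weight (a b c d q : ℝ) (m n : ℕ) : Sym2 (Vertex m n) → ℝ :=
  Sym2.lift ⟨fun
    | Sum.inl p, Sum.inr r => sideWeight a b c d q p r
    | Sum.inr r, Sum.inl p => sideWeight a b c d q p r
    | _, _ => 0, by rintro (p | r) (p' | r') <;> rfl⟩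

/-- The vertices that stay when all bottommost vertices are removed except those at the positions
`s i` (positions are counted from `1`, from left to right). -/
def kept {m : ℕ} (n : ℕ) (s : Fin m → ℕ) : Set (Vertex m n) :=
  {v | ∀ j : Fin n, v = Sum.inl (0, j) → ∃ i, s i = (j : ℕ) + 1}

/-- The matching generating function of the weighted Aztec rectangle graph from which all
bottommost vertices have been removed except those at the positions `s i`. -/
noncomputable def holeyGF (a b c d q : ℝ) {m : ℕ} (n : ℕ) (s : Fin m → ℕ) : ℝ :=
  open scoped Classical in
  matchingGF ((graph m n).induce (kept n s))
    (fun e => weight a b c d q m n (e.map Subtype.val))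

end AztecRectangle

/-! Every edge joins a left/right corner to a top/bottom corner, so the generating function is a
permanent (`matchingGF_eq_perm`). Multiplying each edge weight by factors attached to its two ends
changes the permanent by one global factor (`perm_mul_mul`). This reduces the problem to a = b = 1,
with c, d replaced by c/a, d/b (`holeyGF_eq`).

Rows are then peeled off from the bottom (`rectSum_succ`). Let S be the kept bottom positions, U the
side corners of the bottom row that are matched downward, and T the vertices of the next level that
are left to the rows above. Then U arises from S by raising some entries by one
(`sum_perm_bottomWeight`), T interlaces U (`sum_perm_topWeight`), and the rows above form the same
problem for T with c, d multiplied by q.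

The induction closes because ∏ q^t · Vandermonde(q^t) keeps its shape under this transfer. By
multilinearity both sums act on the rows of a determinant separately. The sum over T gives geometric
series, which turn it into the Vandermonde of q^u in one more variable, divided by ∏ (1 - q^j)
(`interlacingSum_qVandermonde`). The sum over U extracts c + d q^j from column j and restores the
monomial ∏ q^s (`shiftSum_qVandermonde`).

The accumulated constant is evaluated against the Vandermonde of 1, q, …, q^(m-1)
(`rectConst_mul_det`), which supplies the denominators q^j - q^i. The case q = 1 follows by
continuity. -/

namespace BipartiteSum

open Finset

/-! ### Permanents of bipartite weights and their expansions. -/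

section Pairing

variable {α β R : Type*} [CommSemiring R]

/-- The pairs in `M` match the elements of `A` bijectively with the elements of `B`. -/
def IsPairing (M : Finset (α × β)) (A : Finset α) (B : Finset β) : Prop :=
  (∀ e ∈ M, e.1 ∈ A ∧ e.2 ∈ B) ∧ (∀ a ∈ A, ∃! b, (a, b) ∈ M) ∧ ∀ b ∈ B, ∃! a, (a, b) ∈ M

open scoped Classical in
/-- The weighted sum over all bijective pairings of `A` with `B` (the permanent of `w` on
`A × B`, which is `0` unless `A` and `B` have the same size). -/
noncomputable def perm (w : α → β → R) (A : Finset α) (B : Finset β) : R :=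
  ∑ M ∈ (A ×ˢ B).powerset with IsPairing M A B, ∏ e ∈ M, w e.1 e.2

open scoped Classical in
theorem mem_filter_isPairing {M : Finset (α × β)} {A : Finset α} {B : Finset β} :
    M ∈ (A ×ˢ B).powerset.filter (fun M => IsPairing M A B) ↔ IsPairing M A B := by
  rw [mem_filter, mem_powerset, and_iff_right_iff_imp]
  intro h e he
  exact mem_product.2 (h.1 e he)

theorem IsPairing.swap {M : Finset (α × β)} {A : Finset α} {B : Finset β} (h : IsPairing M A B) :
    IsPairing (M.map (Equiv.prodComm α β).toEmbedding) B A := by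
  obtain ⟨h1, h2, h3⟩ := h
  refine ⟨?_, ?_, ?_⟩
  · intro e he
    simp only [mem_map_equiv] at he
    exact (h1 _ he).symm
  · intro b hb
    simpa [mem_map_equiv] using h3 b hb
  · intro a ha
    simpa [mem_map_equiv] using h2 a ha

theorem perm_swap (w : α → β → R) (A : Finset α) (B : Finset β) :
    perm w A B = perm (fun b a => w a b) B A := by
  classical
  unfold perm
  refine sum_bij' (fun M _ => M.map (Equiv.prodComm α β).toEmbedding)
    (fun M _ => M.map (Equiv.prodComm β α).toEmbedding) ?_ ?_ ?_ ?_ ?_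
  · intro M hM
    rw [mem_filter_isPairing] at hM ⊢
    exact hM.swap
  · intro M hM
    rw [mem_filter_isPairing] at hM ⊢
    exact hM.swap
  · intro M _
    ext; simp [mem_map_equiv]
  · intro M _
    ext; simp [mem_map_equiv]
  · intro M _
    simp [prod_map]

theorem perm_empty_left (w : α → β → R) (B : Finset β) [Decidable (B = ∅)] :
    perm w ∅ B = if B = ∅ then 1 else 0 := by
  classical
  unfold perm
  split_ifs with h
  · subst h
    rw [sum_eq_single ∅] <;> simp [IsPairing]
  · apply sum_eq_zero
    intro M hM
    exfalso
    rw [mem_filter_isPairing] at hM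
    obtain ⟨b, hb⟩ := nonempty_iff_ne_empty.2 h
    obtain ⟨a, ha, -⟩ := hM.2.2 b hb
    simpa using (hM.1 _ ha).1

variable [DecidableEq α] [DecidableEq β]

theorem IsPairing.insert {M : Finset (α × β)} {A : Finset α} {B : Finset β} {a : α} {b : β}
    (ha : a ∈ A) (hb : b ∈ B) (h : IsPairing M (A.erase a) (B.erase b)) :
    IsPairing (insert (a, b) M) A B := by
  obtain ⟨h1, h2, h3⟩ := h
  refine ⟨?_, ?_, ?_⟩
  · intro e he
    rcases mem_insert.1 he with rfl | he
    · exact ⟨ha, hb⟩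
    · exact ⟨mem_of_mem_erase (h1 e he).1, mem_of_mem_erase (h1 e he).2⟩
  · intro x hx
    by_cases hxa : x = a
    · subst hxa
      refine ⟨b, by simp, ?_⟩
      intro y hy
      rcases mem_insert.1 hy with hy | hy
      · exact congrArg Prod.snd hy
      · exact absurd (h1 _ hy).1 (by simp)
    · obtain ⟨y, hy, hu⟩ := h2 x (mem_erase.2 ⟨hxa, hx⟩)
      refine ⟨y, mem_insert_of_mem hy, ?_⟩
      intro z hz
      rcases mem_insert.1 hz with hz | hz
      · exact absurd (congrArg Prod.fst hz) hxa
      · exact hu z hz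
  · intro y hy
    by_cases hyb : y = b
    · subst hyb
      refine ⟨a, by simp, ?_⟩
      intro x hx
      rcases mem_insert.1 hx with hx | hx
      · exact congrArg Prod.fst hx
      · exact absurd (h1 _ hx).2 (by simp)
    · obtain ⟨x, hx, hu⟩ := h3 y (mem_erase.2 ⟨hyb, hy⟩)
      refine ⟨x, mem_insert_of_mem hx, ?_⟩
      intro z hz
      rcases mem_insert.1 hz with hz | hz
      · exact absurd (congrArg Prod.snd hz) hyb
      · exact hu z hz

theorem IsPairing.erase {M : Finset (α × β)} {A : Finset α} {B : Finset β} {a : α} {b : β}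
    (h : IsPairing M A B) (hab : (a, b) ∈ M) :
    IsPairing (M.erase (a, b)) (A.erase a) (B.erase b) := by
  obtain ⟨h1, h2, h3⟩ := h
  refine ⟨?_, ?_, ?_⟩
  · rintro ⟨x, y⟩ he
    obtain ⟨hne, hxy⟩ := mem_erase.1 he
    obtain ⟨hx, hy⟩ := h1 _ hxy
    refine ⟨mem_erase.2 ⟨?_, hx⟩, mem_erase.2 ⟨?_, hy⟩⟩
    · rintro rfl
      exact hne (by rw [(h2 x hx).unique hxy hab])
    · rintro rfl
      exact hne (by rw [(h3 y hy).unique hxy hab])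
  · intro x hx
    obtain ⟨hxa, hx⟩ := mem_erase.1 hx
    obtain ⟨y, hy, hu⟩ := h2 x hx
    exact ⟨y, mem_erase.2 ⟨fun h => hxa (congrArg Prod.fst h), hy⟩,
      fun z hz => hu z (mem_of_mem_erase hz)⟩
  · intro y hy
    obtain ⟨hyb, hy⟩ := mem_erase.1 hy
    obtain ⟨x, hx, hu⟩ := h3 y hy
    exact ⟨x, mem_erase.2 ⟨fun h => hyb (congrArg Prod.snd h), hx⟩,
      fun z hz => hu z (mem_of_mem_erase hz)⟩

theorem perm_expand_left (w : α → β → R) {A : Finset α} (B : Finset β) {a : α} (ha : a ∈ A) :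
    perm w A B = ∑ b ∈ B, w a b * perm w (A.erase a) (B.erase b) := by
  classical
  unfold perm
  simp_rw [mul_sum]
  rw [sum_sigma']
  symm
  refine sum_bij (fun x _ => insert (a, x.1) x.2) ?_ ?_ ?_ ?_
  · rintro ⟨b, M⟩ h
    rw [mem_sigma, mem_filter_isPairing] at h
    rw [mem_filter_isPairing]
    exact h.2.insert ha h.1
  · rintro ⟨b, M⟩ h ⟨b', M'⟩ h' heq
    rw [mem_sigma, mem_filter_isPairing] at h h'
    have hn : ∀ y, (a, y) ∉ M := fun y hy => by simpa using (h.2.1 _ hy).1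
    have hn' : ∀ y, (a, y) ∉ M' := fun y hy => by simpa using (h'.2.1 _ hy).1
    have hb : b = b' := by
      have : (a, b) ∈ Insert.insert (a, b') M' := by
        rw [← show Insert.insert (a, b) M = Insert.insert (a, b') M' from heq]; simp
      rcases mem_insert.1 this with h | h
      · exact congrArg Prod.snd h
      · exact absurd h (hn' _)
    subst hb
    have : M = M' := by
      rw [← erase_insert (hn b), ← erase_insert (hn' b)]
      exact congrArg (fun s => s.erase (a, b)) heq
    rw [this]
  · intro M hM
    rw [mem_filter_isPairing] at hM
    obtain ⟨b, hb, -⟩ := hM.2.1 a ha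
    refine ⟨⟨b, M.erase (a, b)⟩, ?_, insert_erase hb⟩
    rw [mem_sigma, mem_filter_isPairing]
    exact ⟨(hM.1 _ hb).2, hM.erase hb⟩
  · rintro ⟨b, M⟩ h
    rw [mem_sigma, mem_filter_isPairing] at h
    have hn : (a, b) ∉ M := fun hy => by simpa using (h.2.1 _ hy).1
    rw [prod_insert hn]

theorem perm_expand_right (w : α → β → R) (A : Finset α) {B : Finset β} {b : β} (hb : b ∈ B) :
    perm w A B = ∑ a ∈ A, w a b * perm w (A.erase a) (B.erase b) := by
  rw [perm_swap, perm_expand_left _ _ hb]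
  exact sum_congr rfl fun a _ => by rw [perm_swap w]

theorem perm_expand_left_of_unique {w : α → β → R} {A : Finset α} {B : Finset β} {a : α} {b : β}
    (ha : a ∈ A) (hb : b ∈ B) (h : ∀ x ∈ B, x ≠ b → w a x = 0) :
    perm w A B = w a b * perm w (A.erase a) (B.erase b) := by
  rw [perm_expand_left w B ha, sum_eq_single b]
  · intro x hx hxb
    rw [h x hx hxb, zero_mul]
  · intro h
    exact absurd hb h

theorem perm_expand_right_of_unique {w : α → β → R} {A : Finset α} {B : Finset β} {a : α} {b : β}
    (ha : a ∈ A) (hb : b ∈ B) (h : ∀ x ∈ A, x ≠ a → w x b = 0) :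
    perm w A B = w a b * perm w (A.erase a) (B.erase b) := by
  rw [perm_swap, perm_expand_left_of_unique hb ha h, perm_swap]

theorem perm_eq_zero_of_left {w : α → β → R} {A : Finset α} {B : Finset β} {a : α}
    (ha : a ∈ A) (h : ∀ b ∈ B, w a b = 0) : perm w A B = 0 := by
  rw [perm_expand_left w B ha]
  exact sum_eq_zero fun b hb => by rw [h b hb, zero_mul]

theorem perm_eq_zero_of_right {w : α → β → R} {A : Finset α} {B : Finset β} {b : β}
    (hb : b ∈ B) (h : ∀ a ∈ A, w a b = 0) : perm w A B = 0 := by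
  rw [perm_swap]
  exact perm_eq_zero_of_left hb h

theorem perm_eq_zero_of_card_ne (w : α → β → R) (A : Finset α) (B : Finset β)
    (h : #A ≠ #B) : perm w A B = 0 := by
  induction A using Finset.induction_on generalizing B with
  | empty =>
    rw [perm_empty_left, if_neg]
    rintro rfl
    exact h rfl
  | insert a A ha ih =>
    rw [perm_expand_left w B (mem_insert_self a A), erase_insert ha]
    refine sum_eq_zero fun b hb => ?_
    rw [ih, mul_zero]
    rw [card_insert_of_notMem ha] at h
    rw [card_erase_of_mem hb]
    have := card_pos.2 ⟨b, hb⟩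
    omega

theorem perm_image {α' β' : Type*} [DecidableEq α'] [DecidableEq β'] {w : α → β → R}
    {w' : α' → β' → R} {f : α → α'} {g : β → β'} {A : Finset α} {B : Finset β}
    (hf : Set.InjOn f A) (hg : Set.InjOn g B)
    (h : ∀ a ∈ A, ∀ b ∈ B, w' (f a) (g b) = w a b) :
    perm w' (A.image f) (B.image g) = perm w A B := by
  induction A using Finset.induction_on generalizing B with
  | empty =>
    simp [perm_empty_left]
  | insert a A ha ih =>
    rw [perm_expand_left w B (mem_insert_self a A), erase_insert ha,
      perm_expand_left w' _ (mem_image_of_mem f (mem_insert_self a A)), sum_image hg]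
    refine sum_congr rfl fun b hb => ?_
    rw [h a (mem_insert_self a A) b hb]
    congr 1
    have h1 : ((Insert.insert a A).image f).erase (f a) = A.image f := by
      rw [image_insert, erase_insert]
      intro hfa
      obtain ⟨x, hx, hxa⟩ := mem_image.1 hfa
      have := hf (by simp [hx]) (by simp) hxa
      exact ha (this ▸ hx)
    have h2 : (B.image g).erase (g b) = (B.erase b).image g := by
      ext y
      simp only [mem_erase, mem_image]
      constructor
      · rintro ⟨hne, x, hx, rfl⟩
        exact ⟨x, ⟨fun hxb => hne (by rw [hxb]), hx⟩, rfl⟩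
      · rintro ⟨x, ⟨hxb, hx⟩, rfl⟩
        exact ⟨fun he => hxb (hg hx hb he), x, hx, rfl⟩
    rw [h1, h2]
    refine ih (hf.mono ?_) (hg.mono ?_) ?_
    · intro x hx
      simp [mem_coe.1 hx]
    · exact fun x hx => mem_of_mem_erase hx
    · exact fun x hx y hy => h x (mem_insert_of_mem hx) y (mem_of_mem_erase hy)

/-- A pairing uses each vertex exactly once, so vertex factors leave the sum. This is the gauge
freedom used to normalise the edge weights. -/
theorem perm_mul_mul (x : α → R) (y : β → R) (w : α → β → R) (A : Finset α) (B : Finset β) :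
    perm (fun a b => x a * y b * w a b) A B = (∏ a ∈ A, x a) * (∏ b ∈ B, y b) * perm w A B := by
  induction A using Finset.induction_on generalizing B with
  | empty =>
    rw [perm_empty_left, perm_empty_left]
    split_ifs with h
    · subst h; simp
    · simp
  | insert a A ha ih =>
    rw [perm_expand_left w B (mem_insert_self a A),
      perm_expand_left _ B (mem_insert_self a A), erase_insert ha, prod_insert ha, mul_sum]
    refine sum_congr rfl fun b hb => ?_
    rw [ih, ← mul_prod_erase B y hb]
    ring

/-- Laplace expansion for permanents: `C` is the set of partners of `A`. -/
theorem perm_union_left (w : α → β → R) {A A' : Finset α} (B : Finset β) (hd : Disjoint A A') :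
    perm w (A ∪ A') B = ∑ C ∈ B.powerset, perm w A C * perm w A' (B \ C) := by
  induction A using Finset.induction_on generalizing B with
  | empty =>
    rw [sum_eq_single ∅]
    · simp [perm_empty_left]
    · intro C _ hC
      rw [perm_empty_left, if_neg hC, zero_mul]
    · simp
  | insert a A ha ih =>
    rw [disjoint_insert_left] at hd
    have ha' : a ∉ A ∪ A' := by simp [ha, hd.1]
    rw [insert_union, perm_expand_left w B (mem_insert_self _ _), erase_insert ha']
    simp_rw [ih _ hd.2, mul_sum]
    have : ∀ C ∈ B.powerset, perm w (Insert.insert a A) C * perm w A' (B \ C) =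
        ∑ b ∈ C, w a b * perm w A (C.erase b) * perm w A' (B \ C) := by
      intro C _
      rw [perm_expand_left w C (mem_insert_self _ _), erase_insert ha, sum_mul]
    rw [sum_congr rfl this, sum_sigma', sum_sigma']
    refine sum_bij' (fun x _ => ⟨Insert.insert x.1 x.2, x.1⟩)
      (fun x _ => ⟨x.2, x.1.erase x.2⟩) ?_ ?_ ?_ ?_ ?_
    · rintro ⟨b, C⟩ h
      simp only [mem_sigma, mem_powerset] at h ⊢
      exact ⟨insert_subset h.1 (h.2.trans (erase_subset _ _)), mem_insert_self _ _⟩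
    · rintro ⟨C, b⟩ h
      simp only [mem_sigma, mem_powerset] at h ⊢
      exact ⟨h.1 h.2, erase_subset_erase _ h.1⟩
    · rintro ⟨b, C⟩ h
      simp only [mem_sigma, mem_powerset] at h
      have : b ∉ C := fun hb => by simpa using h.2 hb
      simp [erase_insert this]
    · rintro ⟨C, b⟩ h
      simp only [mem_sigma, mem_powerset] at h
      simp [insert_erase h.2]
    · rintro ⟨b, C⟩ h
      simp only [mem_sigma, mem_powerset] at h
      have : b ∉ C := fun hb => by simpa using h.2 hb
      have h2 : B.erase b \ C = B \ Insert.insert b C := by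
        ext; simp only [mem_sdiff, mem_erase, mem_insert]; tauto
      simp only [erase_insert this, h2]
      ring

theorem perm_union_right (w : α → β → R) (A : Finset α) {B B' : Finset β} (hd : Disjoint B B') :
    perm w A (B ∪ B') = ∑ C ∈ A.powerset, perm w C B * perm w (A \ C) B' := by
  rw [perm_swap, perm_union_left _ _ hd]
  exact sum_congr rfl fun C _ => by rw [perm_swap w, perm_swap w]

/-- Splitting a layered structure: `A` sees only `B₀` and `B₁`, while `A'` sees only `B₁`
and `B₂`. -/
theorem perm_layers {w : α → β → R} {A A' : Finset α} {B₀ B₁ B₂ : Finset β}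
    (hA : Disjoint A A') (h01 : Disjoint B₀ B₁) (h02 : Disjoint B₀ B₂) (h12 : Disjoint B₁ B₂)
    (hw : ∀ a ∈ A, ∀ b ∈ B₂, w a b = 0) (hw' : ∀ a ∈ A', ∀ b ∈ B₀, w a b = 0) :
    perm w (A ∪ A') (B₀ ∪ B₁ ∪ B₂) =
      ∑ T ∈ B₁.powerset, ∑ U ∈ A.powerset,
        perm w U B₀ * perm w (A \ U) (B₁ \ T) * perm w A' (T ∪ B₂) := by
  rw [perm_union_left _ _ hA]
  have key : ∀ T ∈ B₁.powerset, (∑ U ∈ A.powerset,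
        perm w U B₀ * perm w (A \ U) (B₁ \ T) * perm w A' (T ∪ B₂)) =
      perm w A (B₀ ∪ (B₁ \ T)) * perm w A' (T ∪ B₂) := by
    intro T _
    rw [perm_union_right _ _ (h01.mono_right sdiff_subset), sum_mul]
  rw [sum_congr rfl key]
  symm
  rw [disjoint_left] at h01 h02 h12
  -- A term is nonzero only if `C`, the partner set of `A`, contains `B₀` (unseen by `A'`) and
  -- avoids `B₂` (unseen by `A`). Such a `C` is determined by `T`, the part of `B₁` left to `A'`.
  refine sum_of_injOn (fun T => B₀ ∪ (B₁ \ T)) ?_ ?_ ?_ ?_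
  · intro T hT T' hT' h
    simp only [coe_powerset, Set.mem_preimage, Set.mem_powerset_iff, coe_subset] at hT hT'
    have h' : B₀ ∪ (B₁ \ T) = B₀ ∪ (B₁ \ T') := h
    ext x
    have := congrArg (fun s => x ∈ s) h'
    simp only [mem_union, mem_sdiff, eq_iff_iff] at this
    have := @hT x
    have := @hT' x
    have := @h01 x
    tauto
  · intro T _
    simp only [coe_powerset, Set.mem_preimage, Set.mem_powerset_iff, coe_subset]
    exact (union_subset_union_right sdiff_subset).trans subset_union_left
  · intro C hC hC'
    rw [mem_powerset] at hC
    by_cases h0 : B₀ ⊆ C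
    · by_cases h2 : ∃ b ∈ C, b ∈ B₂
      · obtain ⟨b, hb, hb2⟩ := h2
        rw [perm_eq_zero_of_right hb (fun a ha => hw a ha b hb2), zero_mul]
      · refine absurd ?_ hC'
        refine ⟨B₁ \ C, by simp, ?_⟩
        ext x
        have h0 := @h0 x
        have hC := @hC x
        have h2 : x ∈ C → x ∉ B₂ := fun h h' => h2 ⟨x, h, h'⟩
        simp only [mem_union, mem_sdiff] at hC ⊢
        tauto
    · obtain ⟨b, hb, hbC⟩ := not_subset.1 h0
      rw [perm_eq_zero_of_right (A := A') (b := b) _ (fun a ha => hw' a ha b hb), mul_zero]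
      simp [hb, hbC]
  · intro T hT
    rw [mem_powerset] at hT
    have : (B₀ ∪ B₁ ∪ B₂) \ (B₀ ∪ (B₁ \ T)) = T ∪ B₂ := by
      ext x
      have := @hT x
      have := @h01 x
      have := @h02 x
      have := @h12 x
      simp only [mem_union, mem_sdiff]
      tauto
    rw [this]

end Pairing

/-! ### One row of diamonds: interlacing above, raising by one below. -/

/-- The sum of `φ` over the lists that interlace the decreasing list `l`. -/
def interlacingSum : List ℕ → (List ℕ → ℝ) → ℝ
  | [], _ => 0
  | [_], φ => φ []
  | u :: v :: l, φ => ∑ t ∈ Ico v u, interlacingSum (v :: l) (fun r => φ (t :: r))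

/-- Position `r` is joined to the positions `r` and `r - 1`. -/
def topWeight (r t : ℕ) : ℝ := if t = r ∨ t + 1 = r then 1 else 0

theorem sort_insert_of_lt {T : Finset ℕ} {x : ℕ} (h : ∀ y ∈ T, y < x) :
    (insert x T).sort (· ≥ ·) = x :: T.sort (· ≥ ·) :=
  sort_insert (· ≥ ·) (fun y hy => (h y hy).le) (fun hx => lt_irrefl _ (h x hx))

theorem sum_powerset_range_succ (n : ℕ) (f : Finset ℕ → ℝ) :
    ∑ T ∈ (range (n + 1)).powerset, f T =
      ∑ T ∈ (range n).powerset, f T + ∑ T ∈ (range n).powerset, f (insert n T) := by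
  rw [range_add_one, sum_powerset_insert notMem_range_self]

/-- The side corners 0, …, n and top corners 0, …, n-1 of a row alternate along a path. Deleting the
sides in `l` cuts it into segments. Between consecutive deleted sides v < u there is one more top
than sides, so exactly one t with v ≤ t < u must lie in `T`; the end segments are balanced and
contain no element of `T`. In each admissible case the matching is unique, so the permanent is the
indicator of interlacing. The induction shortens the path at its right end. -/
theorem sum_perm_topWeight (n : ℕ) (l : List ℕ) (hl : l.Pairwise (· > ·)) (hne : l ≠ [])
    (hn : ∀ x ∈ l, x ≤ n) (φ : List ℕ → ℝ) :
    ∑ T ∈ (range n).powerset,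
      perm topWeight (range (n + 1) \ l.toFinset) (range n \ T) * φ (T.sort (· ≥ ·)) =
      interlacingSum l φ := by
  induction n generalizing l φ with
  | zero =>
    match l, hne with
    | [u], _ =>
      have : u = 0 := by simpa using hn u (by simp)
      subst this
      simp [interlacingSum, perm_empty_left]
    | u :: v :: r, _ =>
      have h1 := hn u (by simp)
      have h2 : v < u := (List.pairwise_cons.1 hl).1 v (by simp)
      omega
  | succ n ih =>
    match l, hne with
    | u :: l', _ =>
    obtain ⟨hu, hl'⟩ := List.pairwise_cons.1 hl
    have hun := hn u (by simp)
    rw [sum_powerset_range_succ]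
    have hE : ∀ T ∈ (range n).powerset, n ∉ T := fun T hT h => by
      simpa using mem_powerset.1 hT h
    have hsort : ∀ T ∈ (range n).powerset,
        (insert n T).sort (· ≥ ·) = n :: T.sort (· ≥ ·) := fun T hT =>
      sort_insert_of_lt fun y hy => by simpa using mem_powerset.1 hT hy
    have hrange : ∀ T ∈ (range n).powerset, range (n + 1) \ insert n T = range n \ T := by
      intro T hT
      ext x
      simp only [mem_sdiff, mem_range, mem_insert]
      by_cases hx : x ∈ T
      · simp [hx]
      · simp only [hx, or_false, not_false_eq_true, and_true]
        omega
    rcases hun.lt_or_eq with hlt | rfl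
    -- The last side n + 1 is present and its only neighbour is top n, so n ∉ `T` and this forced
    -- edge is removed.
    · have hmem : n + 1 ∈ range (n + 1 + 1) \ (u :: l').toFinset := by
        simp only [mem_sdiff, mem_range, List.mem_toFinset, List.mem_cons, not_or]
        refine ⟨by omega, by omega, fun h => ?_⟩
        have := hu _ h
        omega
      rw [sum_eq_zero (s := (range n).powerset)
        (f := fun T => perm topWeight _ (range (n + 1) \ insert n T) * _), add_zero]
      · rw [← ih (u :: l') hl (by simp)]
        · refine sum_congr rfl fun T hT => ?_
          have hnT : n ∈ range (n + 1) \ T := by simp [hE T hT]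
          rw [perm_expand_left_of_unique hmem hnT]
          · have h1 : (range (n + 1 + 1) \ (u :: l').toFinset).erase (n + 1) =
                range (n + 1) \ (u :: l').toFinset := by
              ext x
              simp only [mem_sdiff, mem_range, mem_erase]
              constructor
              · rintro ⟨h1, h2, h3⟩
                exact ⟨by omega, h3⟩
              · rintro ⟨h1, h2⟩
                exact ⟨by omega, by omega, h2⟩
            have h2 : (range (n + 1) \ T).erase n = range n \ T := by
              ext x
              simp only [mem_sdiff, mem_range, mem_erase]
              constructor
              · rintro ⟨h1, h2, h3⟩
                exact ⟨by omega, h3⟩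
              · rintro ⟨h1, h2⟩
                exact ⟨by omega, by omega, h2⟩
            rw [h1, h2]
            simp [topWeight]
          · intro x hx hxn
            simp only [mem_sdiff, mem_range] at hx
            rw [topWeight, if_neg]
            omega
        · intro x hx
          rcases List.mem_cons.1 hx with rfl | hx
          · omega
          · have := hu x hx
            omega
      · intro T hT
        rw [perm_eq_zero_of_left hmem, zero_mul]
        intro b hb
        rw [hrange T hT, mem_sdiff, mem_range] at hb
        rw [topWeight, if_neg]
        omega
    -- The last side is deleted. Either top n lies in `T` and heads the interlacing list, or it is
    -- forced onto side n, which then behaves as a deleted side of the shorter path.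
    · have hA : range (n + 1 + 1) \ ((n + 1) :: l').toFinset = range (n + 1) \ l'.toFinset := by
        ext x
        simp only [mem_sdiff, mem_range, List.mem_toFinset, List.mem_cons, not_or]
        constructor
        · rintro ⟨h1, h2, h3⟩
          exact ⟨by omega, h3⟩
        · rintro ⟨h1, h2⟩
          exact ⟨by omega, by omega, h2⟩
      rw [hA]
      have hsecond : ∑ T ∈ (range n).powerset, perm topWeight (range (n + 1) \ l'.toFinset)
            (range (n + 1) \ insert n T) * φ ((insert n T).sort (· ≥ ·)) =
          ∑ T ∈ (range n).powerset, perm topWeight (range (n + 1) \ l'.toFinset)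
            (range n \ T) * φ (n :: T.sort (· ≥ ·)) :=
        sum_congr rfl fun T hT => by rw [hrange T hT, hsort T hT]
      rw [hsecond]
      have hl'n : ∀ x ∈ l', x ≤ n := fun x hx => by
        have := hu x hx
        omega
      have hfirst : n ∉ l' → ∑ T ∈ (range n).powerset,
            perm topWeight (range (n + 1) \ l'.toFinset) (range (n + 1) \ T) *
              φ (T.sort (· ≥ ·)) = interlacingSum (n :: l') φ := by
        intro hnl
        rw [← ih (n :: l') ?_ (by simp)]
        · refine sum_congr rfl fun T hT => ?_
          have hnA : n ∈ range (n + 1) \ l'.toFinset := by simp [hnl]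
          have hnT : n ∈ range (n + 1) \ T := by simp [hE T hT]
          rw [perm_expand_right_of_unique hnA hnT]
          · have h1 : (range (n + 1) \ l'.toFinset).erase n =
                range (n + 1) \ (n :: l').toFinset := by
              ext x
              simp only [mem_sdiff, mem_erase, List.mem_toFinset, List.mem_cons, not_or]
              tauto
            have h2 : (range (n + 1) \ T).erase n = range n \ T := by
              ext x
              simp only [mem_sdiff, mem_range, mem_erase]
              constructor
              · rintro ⟨h1, h2, h3⟩
                exact ⟨by omega, h3⟩
              · rintro ⟨h1, h2⟩
                exact ⟨by omega, by omega, h2⟩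
            rw [h1, h2]
            simp [topWeight]
          · intro x hx hxn
            simp only [mem_sdiff, mem_range] at hx
            rw [topWeight, if_neg]
            omega
        · intro x hx
          rcases List.mem_cons.1 hx with rfl | hx
          · exact le_rfl
          · exact hl'n x hx
        · refine List.pairwise_cons.2 ⟨fun x hx => ?_, hl'⟩
          exact lt_of_le_of_ne (hl'n x hx) (fun h => hnl (h ▸ hx))
      match l' with
      | [] =>
        rw [hfirst (by simp)]
        rw [sum_eq_zero, add_zero]
        · simp [interlacingSum]
        · intro T hT
          rw [perm_eq_zero_of_card_ne, zero_mul]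
          rw [card_sdiff_of_subset (mem_powerset.1 hT)]
          simp
          omega
      | v :: r =>
        rw [ih (v :: r) hl' (by simp) hl'n (fun s => φ (n :: s))]
        have hvn := hl'n v (by simp)
        -- The two cases are the splitting of v ≤ t < n + 1 into t < n and t = n.
        rw [interlacingSum, sum_Ico_succ_top hvn]
        congr 1
        rcases hvn.lt_or_eq with hlt | rfl
        · rw [hfirst, interlacingSum]
          intro hmem
          rcases List.mem_cons.1 hmem with h | h
          · omega
          · have := (List.pairwise_cons.1 hl').1 _ h
            omega
        -- With v = n, side n is deleted as well, so a top n outside `T` has no partner.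
        · rw [Ico_self, sum_empty]
          refine sum_eq_zero fun T hT => ?_
          rw [perm_eq_zero_of_right (b := v), zero_mul]
          · simp [hE T hT]
          · intro x hx
            simp only [mem_sdiff, mem_range, List.mem_toFinset, List.mem_cons, not_or] at hx
            rw [topWeight, if_neg]
            omega

/-- The interlacing sum of a multilinear function is its value at the partial sums. -/
theorem interlacingSum_multilinear {V : Type*} [AddCommGroup V] [Module ℝ V] (k : ℕ)
    (F : MultilinearMap ℝ (fun _ : Fin k => V) ℝ) (x : ℕ → V) (l : List ℕ)
    (hl : l.length = k + 1) :
    interlacingSum l (fun r => F (fun i => x (r.getD i 0))) =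
      F (fun i => ∑ t ∈ Ico (l.getD (i + 1) 0) (l.getD i 0), x t) := by
  induction k generalizing l with
  | zero =>
    match l, hl with
    | [u], _ =>
      rw [interlacingSum]
      congr 1
      ext i
      exact i.elim0
  | succ k ih =>
    match l, hl with
    | u :: v :: l, hl =>
      rw [interlacingSum]
      have h1 : ∀ (t : ℕ) (r : List ℕ), F (fun i => x ((t :: r).getD i 0)) =
          F.curryLeft (x t) (fun i => x (r.getD i 0)) := by
        intro t r
        rw [MultilinearMap.curryLeft_apply]
        congr 1
        ext i
        refine Fin.cases ?_ (fun i => ?_) i <;> simp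
      simp_rw [h1]
      have h2 : F (fun i => ∑ t ∈ Ico ((u :: v :: l).getD (i + 1) 0)
            ((u :: v :: l).getD i 0), x t) =
          F.curryLeft (∑ t ∈ Ico v u, x t) (fun i : Fin k =>
            ∑ t ∈ Ico ((v :: l).getD (i + 1) 0) ((v :: l).getD i 0), x t) := by
        rw [MultilinearMap.curryLeft_apply]
        congr 1
        ext i
        refine Fin.cases ?_ (fun i => ?_) i <;> simp
      rw [h2, map_sum, _root_.sum_apply]
      refine sum_congr rfl fun t _ => ?_
      exact ih _ (v :: l) (by simpa using hl)

/-- Position `s` is joined to the positions `s` and `s + 1`. -/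
def bottomWeight (x y : ℕ → ℝ) (r s : ℕ) : ℝ := if r = s then x s else if r = s + 1 then y s else 0

/-- The weighted sum of `φ` over all ways to raise some of the entries of a list by one. -/
def shiftSum (x y : ℕ → ℝ) : List ℕ → (List ℕ → ℝ) → ℝ
  | [], φ => φ []
  | s :: l, φ => x s * shiftSum x y l (fun r => φ (s :: r)) +
      y s * shiftSum x y l (fun r => φ ((s + 1) :: r))

/-- Lets the largest position be chosen independently of the rest. A collision, where `a` already
lies in `V`, corresponds to no set `U`, but `φ` vanishes on lists with a repeated entry, so such
terms may be added freely. -/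
theorem sum_powerset_erase_sort {A : Finset ℕ} {a : ℕ} (ha : a ∈ A) (P : Finset ℕ → ℝ)
    (hP : ∀ V, (∃ v ∈ V, a < v) → P V = 0) (k : ℕ) (hk : ∀ V, #V ≠ k → P V = 0)
    (φ : List ℕ → ℝ) (hφ : ∀ l, l.length = k + 1 → ¬ l.Nodup → φ l = 0) :
    ∑ U ∈ A.powerset, (if a ∈ U then P (U.erase a) else 0) * φ (U.sort (· ≥ ·)) =
      ∑ V ∈ A.powerset, P V * φ (a :: V.sort (· ≥ ·)) := by
  have h1 : ∑ V ∈ A.powerset, P V * φ (a :: V.sort (· ≥ ·)) =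
      ∑ V ∈ A.powerset with a ∉ V, P V * φ (a :: V.sort (· ≥ ·)) := by
    rw [sum_filter]
    refine sum_congr rfl fun V _ => ?_
    by_cases hV : a ∈ V
    · by_cases hVk : #V = k
      · rw [hφ _ (by simp [hVk]), mul_zero, ite_self]
        simp [hV]
      · rw [hk V hVk, zero_mul, ite_self]
    · rw [if_pos hV]
  rw [h1]
  simp_rw [ite_mul, zero_mul]
  rw [← sum_filter]
  refine sum_bij' (fun U _ => U.erase a) (fun V _ => insert a V) ?_ ?_ ?_ ?_ ?_
  · intro U hU
    simp only [mem_filter, mem_powerset] at hU ⊢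
    exact ⟨(erase_subset _ _).trans hU.1, by simp⟩
  · intro V hV
    simp only [mem_filter, mem_powerset] at hV ⊢
    exact ⟨insert_subset ha hV.1, mem_insert_self _ _⟩
  · intro U hU
    exact insert_erase (mem_filter.1 hU).2
  · intro V hV
    exact erase_insert (mem_filter.1 hV).2
  · intro U hU
    have haU := (mem_filter.1 hU).2
    by_cases hlt : ∃ v ∈ U.erase a, a < v
    · rw [hP _ hlt, zero_mul, zero_mul]
    · push Not at hlt
      congr 2
      conv_lhs => rw [← insert_erase haU]
      exact sort_insert_of_lt fun y hy => lt_of_le_of_ne (hlt y hy) (ne_of_mem_erase hy)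

/-- Each s is matched with s or s + 1. The condition `hφ`, which alternating functions satisfy,
allows the sum to run over all independent choices, including those in which two entries collide. -/
theorem sum_perm_bottomWeight (x y : ℕ → ℝ) (n : ℕ) (l : List ℕ) (hl : l.Pairwise (· > ·))
    (hn : ∀ s ∈ l, s < n) (φ : List ℕ → ℝ)
    (hφ : ∀ r, r.length = l.length → ¬ r.Nodup → φ r = 0) :
    ∑ U ∈ (range (n + 1)).powerset, perm (bottomWeight x y) U l.toFinset * φ (U.sort (· ≥ ·)) =
      shiftSum x y l φ := by
  induction l generalizing φ with
  | nil =>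
    rw [sum_eq_single ∅]
    · simp [perm_empty_left, shiftSum]
    · intro U _ hU
      rw [perm_eq_zero_of_card_ne, zero_mul]
      simpa using hU
    · simp
  | cons s l ih =>
    obtain ⟨hs, hl⟩ := List.pairwise_cons.1 hl
    have hsn := hn s (by simp)
    have hsl : s ∉ l.toFinset := fun h => lt_irrefl _ (hs s (by simpa using h))
    -- The remaining entries are less than s, so even when raised they are at most s; hence the
    -- partner of s is the largest element of `U`.
    have hP : ∀ a, s ≤ a → ∀ V : Finset ℕ, (∃ v ∈ V, a < v) →
        perm (bottomWeight x y) V l.toFinset = 0 := by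
      rintro a ha V ⟨v, hv, hav⟩
      refine perm_eq_zero_of_left hv fun b hb => ?_
      have := hs b (by simpa using hb)
      rw [bottomWeight, if_neg (by omega), if_neg (by omega)]
    have hrec : ∀ a, s ≤ a → a ∈ range (n + 1) →
        ∑ U ∈ (range (n + 1)).powerset,
          (if a ∈ U then perm (bottomWeight x y) (U.erase a) l.toFinset else 0) *
            φ (U.sort (· ≥ ·)) = shiftSum x y l (fun r => φ (a :: r)) := by
      intro a ha han
      rw [sum_powerset_erase_sort han _ (hP a ha) l.length ?_ φ hφ]
      swap
      · intro V hV
        apply perm_eq_zero_of_card_ne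
        rwa [List.toFinset_card_of_nodup (hl.imp ne_of_gt)]
      refine ih hl (fun b hb => hn b (by simp [hb])) _ fun r hrl hr => hφ _ (by simp [hrl]) ?_
      rw [List.nodup_cons]
      exact fun h => hr h.2
    rw [shiftSum, ← hrec s le_rfl (by simp; omega), ← hrec (s + 1) (by omega) (by simp; omega),
      mul_sum, mul_sum, ← sum_add_distrib]
    refine sum_congr rfl fun U _ => ?_
    rw [List.toFinset_cons, perm_expand_right _ _ (mem_insert_self _ _), erase_insert hsl]
    have : ∀ a ∈ U, bottomWeight x y a s * perm (bottomWeight x y) (U.erase a) l.toFinset =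
        (if a = s then x s * perm (bottomWeight x y) (U.erase a) l.toFinset else 0) +
        (if a = s + 1 then y s * perm (bottomWeight x y) (U.erase a) l.toFinset else 0) := by
      intro a _
      rw [bottomWeight]
      split_ifs <;> first | omega | simp
    rw [sum_congr rfl this, sum_add_distrib, sum_ite_eq', sum_ite_eq']
    split_ifs <;> ring

/-- The shift sum of a multilinear function is its value at the shifted vectors. -/
theorem shiftSum_multilinear {V : Type*} [AddCommGroup V] [Module ℝ V] (x y : ℕ → ℝ) (k : ℕ)
    (F : MultilinearMap ℝ (fun _ : Fin k => V) ℝ) (g : ℕ → V) (l : List ℕ)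
    (hl : l.length = k) :
    shiftSum x y l (fun r => F (fun i => g (r.getD i 0))) =
      F (fun i => x (l.getD i 0) • g (l.getD i 0) + y (l.getD i 0) • g (l.getD i 0 + 1)) := by
  induction k generalizing l with
  | zero =>
    match l, hl with
    | [], _ =>
      rw [shiftSum]
      congr 1
      ext i
      exact i.elim0
  | succ k ih =>
    match l, hl with
    | s :: l, hl =>
      rw [shiftSum]
      have h1 : ∀ (t : ℕ) (r : List ℕ), F (fun i => g ((t :: r).getD i 0)) =
          F.curryLeft (g t) (fun i => g (r.getD i 0)) := by
        intro t r
        rw [MultilinearMap.curryLeft_apply]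
        congr 1
        ext i
        refine Fin.cases ?_ (fun i => ?_) i <;> simp
      simp_rw [h1]
      have h2 : F (fun i => x ((s :: l).getD i 0) • g ((s :: l).getD i 0) +
            y ((s :: l).getD i 0) • g ((s :: l).getD i 0 + 1)) =
          F.curryLeft (x s • g s + y s • g (s + 1)) (fun i : Fin k =>
            x (l.getD i 0) • g (l.getD i 0) + y (l.getD i 0) • g (l.getD i 0 + 1)) := by
        rw [MultilinearMap.curryLeft_apply]
        congr 1
        ext i
        refine Fin.cases ?_ (fun i => ?_) i <;> simp
      have hl' : l.length = k := by simpa using hl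
      rw [h2, ih _ l hl', ih _ l hl', map_add, map_smul, map_smul]
      rfl

/-! ### Action of the row transfer on Vandermonde determinants. -/

/-- The Vandermonde determinant in the powers of `q` given by the first `k` entries of `l`. -/
noncomputable def qVandermonde (q : ℝ) (k : ℕ) (l : List ℕ) : ℝ :=
  (Matrix.vandermonde (fun i : Fin k => q ^ l.getD i 0)).det

theorem qVandermonde_eq_detRow (q : ℝ) (k : ℕ) (l : List ℕ) :
    qVandermonde q k l = (Matrix.detRowAlternating (n := Fin k) (R := ℝ)).toMultilinearMap
      (fun i => (fun t j => (q ^ t) ^ (j : ℕ) : ℕ → Fin k → ℝ) (l.getD i 0)) :=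
  rfl

/-- The generalized Vandermonde determinant with exponents `1, …, k`. -/
theorem prod_mul_qVandermonde (q : ℝ) (k : ℕ) (l : List ℕ) :
    (∏ i : Fin k, q ^ l.getD i 0) * qVandermonde q k l =
      (Matrix.detRowAlternating (n := Fin k) (R := ℝ)).toMultilinearMap
      (fun i => (fun t j => (q ^ t) ^ ((j : ℕ) + 1) : ℕ → Fin k → ℝ) (l.getD i 0)) := by
  rw [qVandermonde, ← Matrix.det_mul_column]
  change _ = Matrix.det _
  congr 1
  ext i j
  simp [Matrix.vandermonde, pow_succ']

theorem qVandermonde_eq_zero (q : ℝ) (l : List ℕ) (h : ¬ l.Nodup) :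
    qVandermonde q l.length l = 0 := by
  rw [List.nodup_iff_injective_get, Function.Injective] at h
  push Not at h
  obtain ⟨i, j, hij, hne⟩ := h
  refine Matrix.det_zero_of_row_eq hne ?_
  ext k
  have : l[(i : ℕ)] = l[(j : ℕ)] := hij
  simp [Matrix.vandermonde, this]

/-- Row i becomes a sum of q^(t(j+1)) over consecutive t. Multiplying column j by 1 - q^(j+1)
telescopes it to a difference of two consecutive rows of the Vandermonde matrix of size k + 1. -/
theorem interlacingSum_qVandermonde (q : ℝ) (hq : ∀ j : ℕ, q ^ (j + 1) ≠ 1) (k : ℕ) (l : List ℕ)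
    (hk : l.length = k + 1) (hl : l.Pairwise (· > ·)) :
    interlacingSum l (fun r => (∏ i : Fin k, q ^ r.getD i 0) * qVandermonde q k r) =
      qVandermonde q (k + 1) l / ∏ j : Fin k, (1 - q ^ ((j : ℕ) + 1)) := by
  simp_rw [prod_mul_qVandermonde]
  rw [interlacingSum_multilinear k _ (fun t (j : Fin k) => (q ^ t) ^ ((j : ℕ) + 1)) l hk]
  have hne : ∀ j : ℕ, (1 - q ^ (j + 1)) ≠ 0 := fun j => sub_ne_zero.2 (hq j).symm
  rw [eq_div_iff (prod_ne_zero_iff.2 fun (j : Fin k) _ => hne j), mul_comm]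
  refine (Matrix.det_mul_row (fun j : Fin k => 1 - q ^ ((j : ℕ) + 1)) (Matrix.of fun i j : Fin k =>
    (∑ t ∈ Ico (l.getD (i + 1) 0) (l.getD i 0),
      fun j : Fin k => (q ^ t) ^ ((j : ℕ) + 1)) j)).symm.trans ?_
  -- The Vandermonde matrix with its preceding row subtracted from each row after the first. Its
  -- column of ones becomes (1, 0, …, 0), so expanding along it leaves the required k × k minor.
  let B : Matrix (Fin (k + 1)) (Fin (k + 1)) ℝ := fun i j =>
    Fin.cases (motive := fun _ => ℝ) ((q ^ l.getD 0 0) ^ (j : ℕ))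
      (fun i => (q ^ l.getD (i + 1) 0) ^ (j : ℕ) - (q ^ l.getD i 0) ^ (j : ℕ)) i
  have hB : qVandermonde q (k + 1) l = B.det := by
    refine Matrix.det_eq_of_forall_row_eq_smul_add_pred (fun _ => 1) ?_ ?_
    · intro j
      simp [B, Matrix.vandermonde]
    · intro i j
      simp [B, Matrix.vandermonde]
  rw [hB, Matrix.det_succ_column_zero, Fin.sum_univ_succ]
  rw [sum_eq_zero, add_zero]
  · have : B 0 0 = 1 := by simp [B]
    rw [this]
    simp only [Fin.val_zero, pow_zero, one_mul]
    congr 1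
    ext i j
    have hle : l.getD (i + 1) 0 ≤ l.getD i 0 := by
      have h1 : (i : ℕ) < l.length := by omega
      have h2 : (i : ℕ) + 1 < l.length := by omega
      rw [List.getD_eq_getElem _ _ h1, List.getD_eq_getElem _ _ h2]
      exact (List.pairwise_iff_getElem.1 hl i (i + 1) h1 h2 (by omega)).le
    have hBij : B.submatrix (Fin.succAbove 0) Fin.succ i j =
      (q ^ l.getD (i + 1) 0) ^ ((j : ℕ) + 1) - (q ^ l.getD i 0) ^ ((j : ℕ) + 1) := rfl
    rw [hBij]
    simp only [Matrix.of_apply, Finset.sum_apply]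
    simp_rw [← pow_mul, mul_comm _ ((j : ℕ) + 1), pow_mul q ((j : ℕ) + 1)]
    rw [← neg_inj, ← neg_mul, neg_sub, mul_comm, geom_sum_Ico_mul _ hle]
    ring
  · intro i _
    have : B i.succ 0 = 0 := by simp [B]
    rw [this]
    ring

/-- The entry c q^s q^(sj) + d q^s q^((s+1)j) equals (c + d q^j) q^(s(j+1)): a column factor times
the entry with exponent raised by one. -/
theorem shiftSum_qVandermonde (q c d : ℝ) (l : List ℕ) :
    shiftSum (fun s => c * q ^ s) (fun s => d * q ^ s) l (qVandermonde q l.length) =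
      (∏ j : Fin l.length, (c + d * q ^ (j : ℕ))) *
        ((∏ i : Fin l.length, q ^ l.getD i 0) * qVandermonde q l.length l) := by
  have : qVandermonde q l.length = fun r =>
      (Matrix.detRowAlternating (n := Fin l.length) (R := ℝ)).toMultilinearMap
      (fun i => (fun t j => (q ^ t) ^ (j : ℕ) : ℕ → Fin l.length → ℝ) (r.getD i 0)) := by
    funext r
    exact qVandermonde_eq_detRow q _ r
  rw [prod_mul_qVandermonde, this,
    shiftSum_multilinear _ _ _ _ (fun t (j : Fin l.length) => (q ^ t) ^ (j : ℕ)) l rfl]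
  refine Eq.trans ?_ (Matrix.det_mul_row (fun j : Fin l.length => c + d * q ^ (j : ℕ))
    (Matrix.of fun i j : Fin l.length => (q ^ l.getD i 0) ^ ((j : ℕ) + 1)))
  refine congrArg Matrix.det ?_
  ext i j
  simp only [Matrix.of_apply, Pi.add_apply, Pi.smul_apply, smul_eq_mul]
  ring

/-- The self-reproducing property: one row of diamonds turns the k-variable function into the same
function of k + 1 variables. -/
theorem sum_transfer (q c d : ℝ) (hq : ∀ j : ℕ, q ^ (j + 1) ≠ 1) (n k : ℕ) (l : List ℕ)
    (hk : l.length = k + 1) (hl : l.Pairwise (· > ·)) (hn : ∀ x ∈ l, x < n) :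
    ∑ T ∈ (range n).powerset, ∑ U ∈ (range (n + 1)).powerset,
      perm (bottomWeight (fun s => c * q ^ s) (fun s => d * q ^ s)) U l.toFinset *
        perm topWeight (range (n + 1) \ U) (range n \ T) *
          ((∏ i : Fin k, q ^ (T.sort (· ≥ ·)).getD i 0) * qVandermonde q k (T.sort (· ≥ ·))) =
      (∏ j : Fin (k + 1), (c + d * q ^ (j : ℕ))) / (∏ j : Fin k, (1 - q ^ ((j : ℕ) + 1))) *
        ((∏ i : Fin (k + 1), q ^ l.getD i 0) * qVandermonde q (k + 1) l) := by
  rw [sum_comm]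
  have h1 : ∀ U ∈ (range (n + 1)).powerset, (∑ T ∈ (range n).powerset,
      perm (bottomWeight (fun s => c * q ^ s) (fun s => d * q ^ s)) U l.toFinset *
        perm topWeight (range (n + 1) \ U) (range n \ T) *
          ((∏ i : Fin k, q ^ (T.sort (· ≥ ·)).getD i 0) * qVandermonde q k (T.sort (· ≥ ·)))) =
      perm (bottomWeight (fun s => c * q ^ s) (fun s => d * q ^ s)) U l.toFinset *
        qVandermonde q (k + 1) (U.sort (· ≥ ·)) / ∏ j : Fin k, (1 - q ^ ((j : ℕ) + 1)) := by
    intro U hU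
    simp_rw [mul_assoc]
    rw [← mul_sum, mul_div_assoc]
    by_cases hUk : #U = k + 1
    · congr 1
      have := sum_perm_topWeight n (U.sort (· ≥ ·)) (sortedGT_sort U).pairwise
        (fun h => by simpa [hUk] using congrArg List.length h)
        (fun x hx => by
          have := mem_powerset.1 hU ((mem_sort _).1 hx)
          simp at this
          omega)
        (fun r => (∏ i : Fin k, q ^ r.getD i 0) * qVandermonde q k r)
      rw [sort_toFinset] at this
      rw [this, interlacingSum_qVandermonde q hq k _ (by simp [hUk]) (sortedGT_sort U).pairwise]
    · rw [perm_eq_zero_of_card_ne, zero_mul, zero_mul]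
      rwa [List.toFinset_card_of_nodup (hl.imp ne_of_gt), hk]
  rw [sum_congr rfl h1, ← sum_div, div_mul_eq_mul_div]
  congr 1
  rw [← hk, sum_perm_bottomWeight _ _ n l hl hn, shiftSum_qVandermonde]
  intro r hr hnd
  rw [← hr]
  exact qVandermonde_eq_zero q r hnd

/-! ### Recursion over the rows of the rectangle. -/

/-- The weight of the edge of the square lattice between the side corner `r` and the top or bottom
corner `p`, where edges above `r` have weight `1`. -/
noncomputable def latticeWeight (c d q : ℝ) (r p : ℕ × ℕ) : ℝ :=
  if p.1 = r.1 + 1 then topWeight r.2 p.2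
  else if p.1 = r.1 then
    bottomWeight (fun s => c * q ^ (r.1 + s)) (fun s => d * q ^ (r.1 + s)) r.2 p.2
  else 0

/-- The matching sum of the Aztec rectangle with `m` rows, `n` columns and bottom vertices `S`. -/
noncomputable def rectSum (q : ℝ) (n m : ℕ) (c d : ℝ) (S : Finset ℕ) : ℝ :=
  perm (latticeWeight c d q) (range m ×ˢ range (n + 1)) ({0} ×ˢ S ∪ Icc 1 m ×ˢ range n)

theorem sum_powerset_image {β γ : Type*} [DecidableEq β] [DecidableEq γ] (B : Finset β)
    {g : β → γ} (hg : Function.Injective g) (f : Finset γ → ℝ) :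
    ∑ T ∈ (B.image g).powerset, f T = ∑ T ∈ B.powerset, f (T.image g) := by
  rw [powerset_image, sum_image]
  intro T _ T' _ h
  exact image_injective hg h

theorem rectSum_succ (q : ℝ) (n m : ℕ) (c d : ℝ) (S : Finset ℕ) :
    rectSum q n (m + 1) c d S =
      ∑ T ∈ (range n).powerset, ∑ U ∈ (range (n + 1)).powerset,
        perm (bottomWeight (fun s => c * q ^ s) (fun s => d * q ^ s)) U S *
          perm topWeight (range (n + 1) \ U) (range n \ T) *
            rectSum q n m (c * q) (d * q) T := by
  have hinj : ∀ i : ℕ, Function.Injective (Prod.mk i : ℕ → ℕ × ℕ) :=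
    fun i => Prod.mk_right_injective i
  have hA : range (m + 1) ×ˢ range (n + 1) =
      (range (n + 1)).image (Prod.mk 0) ∪ Icc 1 m ×ˢ range (n + 1) := by
    ext ⟨i, j⟩
    simp only [mem_product, mem_range, mem_union, mem_image, Prod.mk.injEq, exists_eq_right_right,
      mem_Icc]
    omega
  have hB : {0} ×ˢ S ∪ Icc 1 (m + 1) ×ˢ range n =
      S.image (Prod.mk 0) ∪ (range n).image (Prod.mk 1) ∪ Icc 2 (m + 1) ×ˢ range n := by
    ext ⟨i, j⟩
    simp only [mem_product, mem_range, mem_union, mem_image, Prod.mk.injEq, exists_eq_right_right,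
      mem_Icc, mem_singleton]
    by_cases hj : j ∈ S
    · simp only [hj, and_true, true_and]
      omega
    · simp only [hj, and_false, false_and, false_or]
      omega
  rw [rectSum, hA, hB, perm_layers]
  · rw [sum_powerset_image _ (hinj 1)]
    refine sum_congr rfl fun T _ => ?_
    rw [sum_powerset_image _ (hinj 0)]
    refine sum_congr rfl fun U _ => ?_
    rw [← image_sdiff _ _ (hinj 0), ← image_sdiff _ _ (hinj 1)]
    congr 1
    · congr 1
      · refine perm_image (hinj 0).injOn (hinj 0).injOn fun r _ s _ => ?_
        simp [latticeWeight]
      · refine perm_image (hinj 0).injOn (hinj 1).injOn fun r _ s _ => ?_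
        simp [latticeWeight]
    · have hs : Function.Injective (fun p : ℕ × ℕ => (p.1 + 1, p.2)) := by
        rintro ⟨i, j⟩ ⟨i', j'⟩ h
        simpa using h
      have h1 : Icc 1 m ×ˢ range (n + 1) =
          (range m ×ˢ range (n + 1)).image (fun p => (p.1 + 1, p.2)) := by
        ext ⟨i, j⟩
        simp only [mem_product, mem_Icc, mem_range, mem_image, Prod.exists, Prod.mk.injEq]
        constructor
        · rintro ⟨⟨h1, h2⟩, h3⟩
          exact ⟨i - 1, j, by omega, by omega, rfl⟩
        · rintro ⟨i, j, h, rfl, rfl⟩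
          omega
      have h2 : T.image (Prod.mk 1) ∪ Icc 2 (m + 1) ×ˢ range n =
          ({0} ×ˢ T ∪ Icc 1 m ×ˢ range n).image (fun p => (p.1 + 1, p.2)) := by
        ext ⟨i, j⟩
        simp only [mem_union, mem_product, mem_Icc, mem_range, mem_image, Prod.exists,
          Prod.mk.injEq, mem_singleton]
        constructor
        · rintro (⟨j, hj, rfl, rfl⟩ | ⟨⟨h1, h2⟩, h3⟩)
          · exact ⟨0, j, Or.inl ⟨rfl, hj⟩, rfl, rfl⟩
          · exact ⟨i - 1, j, Or.inr ⟨by omega, h3⟩, by omega, rfl⟩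
        · rintro ⟨i, j, ⟨rfl, hj⟩ | ⟨⟨h1, h2⟩, h3⟩, rfl, rfl⟩
          · exact Or.inl ⟨j, hj, rfl, rfl⟩
          · exact Or.inr ⟨⟨by omega, by omega⟩, h3⟩
      rw [rectSum, h1, h2]
      refine perm_image hs.injOn hs.injOn fun r _ s _ => ?_
      simp only [latticeWeight, Nat.add_right_cancel_iff]
      -- Lowering the upper rows by one level moves a factor q from the weights into c and d.
      have e : ∀ (x : ℝ) (t : ℕ), x * q ^ (r.1 + 1 + t) = x * q * q ^ (r.1 + t) := by
        intro x t
        ring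
      simp_rw [e]
  · rw [disjoint_left]
    rintro ⟨i, j⟩ h h'
    simp only [mem_image, Prod.mk.injEq, mem_product, mem_Icc] at h h'
    omega
  · rw [disjoint_left]
    rintro ⟨i, j⟩ h h'
    simp only [mem_image, Prod.mk.injEq] at h h'
    omega
  · rw [disjoint_left]
    rintro ⟨i, j⟩ h h'
    simp only [mem_image, Prod.mk.injEq, mem_product, mem_Icc] at h h'
    omega
  · rw [disjoint_left]
    rintro ⟨i, j⟩ h h'
    simp only [mem_image, Prod.mk.injEq, mem_product, mem_Icc] at h h'
    omega
  · rintro ⟨i, j⟩ h ⟨i', j'⟩ h'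
    simp only [mem_image, Prod.mk.injEq, mem_product, mem_Icc] at h h'
    rw [latticeWeight, if_neg (by omega), if_neg (by omega)]
  · rintro ⟨i, j⟩ h ⟨i', j'⟩ h'
    simp only [mem_image, Prod.mk.injEq, mem_product, mem_Icc] at h h'
    rw [latticeWeight, if_neg (by omega), if_neg (by omega)]

/-- The constant factor of `rectSum`. -/
noncomputable def rectConst (q : ℝ) : ℕ → ℝ → ℝ → ℝ
  | 0, _, _ => 1
  | m + 1, c, d => (∏ j : Fin (m + 1), (c + d * q ^ (j : ℕ))) /
      (∏ j : Fin m, (1 - q ^ ((j : ℕ) + 1))) * rectConst q m (c * q) (d * q)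

theorem rectSum_eq (q : ℝ) (hq : ∀ j : ℕ, q ^ (j + 1) ≠ 1) (n m : ℕ) (c d : ℝ) (l : List ℕ)
    (hlen : l.length = m) (hl : l.Pairwise (· > ·)) (hn : ∀ x ∈ l, x < n) :
    rectSum q n m c d l.toFinset =
      rectConst q m c d * ((∏ i : Fin m, q ^ l.getD i 0) * qVandermonde q m l) := by
  induction m generalizing c d l with
  | zero =>
    have : l = [] := List.length_eq_zero_iff.1 hlen
    subst this
    simp [rectSum, rectConst, perm_empty_left, qVandermonde]
  | succ m ih =>
    rw [rectSum_succ, rectConst, mul_right_comm, ← sum_transfer q c d hq n m l hlen hl hn, sum_mul]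
    refine sum_congr rfl fun T hT => ?_
    rw [sum_mul]
    refine sum_congr rfl fun U hU => ?_
    rw [mul_assoc _ _ (rectConst q m _ _)]
    by_cases hTm : #T = m
    · have := ih (c * q) (d * q) (T.sort (· ≥ ·)) (by simp [hTm]) (sortedGT_sort T).pairwise
        (fun x hx => by simpa using mem_powerset.1 hT ((mem_sort _).1 hx))
      rw [sort_toFinset] at this
      rw [this, mul_comm (rectConst q m _ _)]
    -- Counting vertices in the bottom row forces #`T` = m; other sets contribute nothing.
    · have : perm (bottomWeight (fun s => c * q ^ s) (fun s => d * q ^ s)) U l.toFinset *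
          perm topWeight (range (n + 1) \ U) (range n \ T) = 0 := by
        by_cases hUm : #U = m + 1
        · rw [perm_eq_zero_of_card_ne topWeight, mul_zero]
          rw [card_sdiff_of_subset (mem_powerset.1 hT), card_sdiff_of_subset (mem_powerset.1 hU)]
          have h1 := card_le_card (mem_powerset.1 hT)
          have h2 := card_le_card (mem_powerset.1 hU)
          simp only [card_range] at *
          omega
        · rw [perm_eq_zero_of_card_ne, zero_mul]
          rwa [List.toFinset_card_of_nodup (hl.imp ne_of_gt), hlen]
      rw [this, zero_mul, zero_mul]

/-! ### Perfect matchings of a bipartite graph as a permanent. -/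

theorem matchingGF_eq_perm {V : Type*} [Fintype V] [DecidableEq V] (G : SimpleGraph V)
    [DecidableRel G.Adj] (w : Sym2 V → ℝ) (X : Finset V)
    (hX : ∀ u v, G.Adj u v → (u ∈ X ↔ v ∉ X)) :
    AztecRectangle.matchingGF G w =
      perm (fun u v => if G.Adj u v then w s(u, v) else 0) X Xᶜ := by
  classical
  unfold AztecRectangle.matchingGF perm
  refine sum_of_injOn
    (fun H => (X ×ˢ Xᶜ).filter (fun e => H.1.Adj e.1 e.2)) ?_ ?_ ?_ ?_
  · rintro ⟨H, hH⟩ _ H' _ h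
    obtain ⟨H', hH'⟩ := H'
    have h' : (X ×ˢ Xᶜ).filter (fun e => H.Adj e.1 e.2) =
      (X ×ˢ Xᶜ).filter (fun e => H'.Adj e.1 e.2) := h
    have key : ∀ u v, u ∈ X → v ∉ X → (H.Adj u v ↔ H'.Adj u v) := by
      intro u v hu hv
      have := congrArg (fun s => (u, v) ∈ s) h'
      simpa [hu, hv] using this
    have hadj : H.Adj = H'.Adj := by
      funext u v
      apply propext
      by_cases hu : u ∈ X
      · by_cases hv : v ∈ X
        · constructor
          · intro h
            exact absurd hv ((hX u v h.adj_sub).1 hu)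
          · intro h
            exact absurd hv ((hX u v h.adj_sub).1 hu)
        · exact key u v hu hv
      · by_cases hv : v ∈ X
        · rw [H.adj_comm, H'.adj_comm]
          exact key v u hv hu
        · constructor
          · intro h
            exact absurd ((hX u v h.adj_sub).2 hv) hu
          · intro h
            exact absurd ((hX u v h.adj_sub).2 hv) hu
    have hverts : H.verts = H'.verts := by
      rw [SimpleGraph.Subgraph.isSpanning_iff.1 hH.2, SimpleGraph.Subgraph.isSpanning_iff.1 hH'.2]
    exact Subtype.ext (SimpleGraph.Subgraph.ext hverts hadj)
  · rintro ⟨H, hH⟩ _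
    rw [mem_coe, mem_filter_isPairing]
    rw [SimpleGraph.Subgraph.isPerfectMatching_iff] at hH
    refine ⟨fun e he => mem_product.1 (mem_filter.1 he).1, ?_, ?_⟩
    · intro u hu
      obtain ⟨v, hv, huniq⟩ := hH u
      have hvX := (hX u v hv.adj_sub).1 hu
      exact ⟨v, by simp [hu, hvX, hv], fun z hz => huniq z (by simpa using (mem_filter.1 hz).2)⟩
    · intro v hv
      rw [mem_compl] at hv
      obtain ⟨u, hu, huniq⟩ := hH v
      have huX := (hX u v hu.adj_sub.symm).2 hv
      refine ⟨u, by simp [hv, huX, hu.symm], fun z hz => huniq z ?_⟩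
      exact SimpleGraph.Subgraph.Adj.symm (by simpa using (mem_filter.1 hz).2)
  · intro M hM hM'
    rw [mem_filter_isPairing] at hM
    -- A pairing made of edges comes from a perfect matching; one that uses a non-edge has product
    -- 0.
    by_cases hall : ∀ e ∈ M, G.Adj e.1 e.2
    · refine absurd ?_ hM'
      let H : G.Subgraph :=
        { verts := Set.univ
          Adj := fun u v => (u, v) ∈ M ∨ (v, u) ∈ M
          adj_sub := by
            rintro u v (h | h)
            · exact hall _ h
            · exact (hall _ h).symm
          edge_vert := fun _ => Set.mem_univ _
          symm := ⟨fun u v h => h.symm⟩ }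
      have hH : H.IsPerfectMatching := by
        rw [SimpleGraph.Subgraph.isPerfectMatching_iff]
        intro v
        by_cases hv : v ∈ X
        · obtain ⟨z, hz, hu⟩ := hM.2.1 v hv
          refine ⟨z, Or.inl hz, ?_⟩
          rintro y (hy | hy)
          · exact hu y hy
          · exact absurd hv (mem_compl.1 (hM.1 _ hy).2)
        · obtain ⟨z, hz, hu⟩ := hM.2.2 v (mem_compl.2 hv)
          refine ⟨z, Or.inr hz, ?_⟩
          rintro y (hy | hy)
          · exact absurd (hM.1 _ hy).1 hv
          · exact hu y hy
      refine ⟨⟨H, hH⟩, by simp, ?_⟩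
      ext ⟨u, v⟩
      simp only [mem_filter, mem_product, mem_compl]
      constructor
      · rintro ⟨⟨hu, hv⟩, h | h⟩
        · exact h
        · exact absurd (hM.1 _ h).1 hv
      · intro h
        have := hM.1 _ h
        rw [mem_compl] at this
        exact ⟨this, Or.inl h⟩
    · push Not at hall
      obtain ⟨e, he, hne⟩ := hall
      exact prod_eq_zero he (if_neg hne)
  · rintro ⟨H, hH⟩ _
    symm
    refine prod_bij (fun e _ => s(e.1, e.2)) ?_ ?_ ?_ ?_
    · intro e he
      simpa using (mem_filter.1 he).2
    · rintro ⟨u, v⟩ he ⟨u', v'⟩ he' h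
      simp only [mem_filter, mem_product, mem_compl] at he he'
      rcases Sym2.eq_iff.1 h with ⟨h1, h2⟩ | ⟨h1, h2⟩
      · exact Prod.ext h1 h2
      · simp only at h1 h2
        exact absurd (h1 ▸ he.1.1) he'.1.2
    · intro e he
      induction e using Sym2.ind with
      | _ u v =>
        have h : H.Adj u v := by simpa using he
        by_cases hu : u ∈ X
        · exact ⟨(u, v), by simp [hu, h, (hX u v h.adj_sub).1 hu], rfl⟩
        · have hv : v ∈ X := by
            by_contra hv
            exact hu ((hX u v h.adj_sub).2 hv)
          exact ⟨(v, u), by simp [hu, h.symm, hv], Sym2.eq_swap⟩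
    · intro e he
      exact if_pos (H.adj_sub (mem_filter.1 he).2)

/-! ### Evaluation of the constant factor. -/

/-- The row transfer uses decreasing lists, while `s` increases. The sign of the reversal cancels in
the quotient. -/
theorem det_vandermonde_rev_div (m : ℕ) (v w : Fin m → ℝ) :
    (Matrix.vandermonde (fun i => v i.rev)).det / (Matrix.vandermonde (fun i => w i.rev)).det =
      ∏ i : Fin m, ∏ j ∈ Ioi i, (v j - v i) / (w j - w i) := by
  have key : ∀ u : Fin m → ℝ, (Matrix.vandermonde (fun i => u i.rev)).det =
      ((Equiv.Perm.sign (Fin.revPerm : Equiv.Perm (Fin m)) : ℤ) : ℝ) *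
        ∏ i : Fin m, ∏ j ∈ Ioi i, (u j - u i) := fun u => by
    rw [← Matrix.det_vandermonde, ← Matrix.det_permute]
    rfl
  have hs : ((Equiv.Perm.sign (Fin.revPerm : Equiv.Perm (Fin m)) : ℤ) : ℝ) ≠ 0 := by
    simp
  rw [key, key, mul_div_mul_left _ _ hs, ← prod_div_distrib]
  simp_rw [← prod_div_distrib]

/-- The pairs containing the first node q^m contribute q^(m-1-j) - q^m = q^(m-1-j) (1 - q^(j+1)). -/
theorem det_vandermonde_pow_succ (q : ℝ) (m : ℕ) :
    (Matrix.vandermonde (fun i : Fin (m + 1) => q ^ (m - (i : ℕ)))).det =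
      q ^ (∑ j ∈ range m, j) * (∏ j : Fin m, (1 - q ^ ((j : ℕ) + 1))) *
        (Matrix.vandermonde (fun i : Fin m => q ^ (m - 1 - (i : ℕ)))).det := by
  rw [Matrix.det_vandermonde, Matrix.det_vandermonde, Fin.prod_univ_succ, Fin.prod_Ioi_zero]
  congr 1
  · rw [← prod_pow_eq_pow_sum, ← prod_range_reflect, ← Fin.prod_univ_eq_prod_range,
      ← prod_mul_distrib]
    refine prod_congr rfl fun j _ => ?_
    rw [mul_sub, mul_one, ← pow_add, Fin.val_succ, Fin.val_zero]
    congr 2 <;> omega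
  · refine prod_congr rfl fun i _ => ?_
    rw [Fin.prod_Ioi_succ]
    refine prod_congr rfl fun j _ => ?_
    rw [Fin.val_succ, Fin.val_succ]
    congr 2 <;> omega

/-- The denominators accumulated in `rectConst` are, up to a power of q, the Vandermonde of q^(m-1),
…, q, 1. In the induction, Σ k from that determinant and Σ (m - k) from scaling c, d by q add up to
m². -/
theorem rectConst_mul_det (q : ℝ) (hq : ∀ j : ℕ, q ^ (j + 1) ≠ 1) (m : ℕ) (c d : ℝ) :
    rectConst q m c d * (Matrix.vandermonde (fun i : Fin m => q ^ (m - 1 - (i : ℕ)))).det =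
      q ^ (∑ k ∈ range m, k ^ 2) * ∏ k ∈ range m, (c + d * q ^ k) ^ (m - k) := by
  induction m generalizing c d with
  | zero => simp [rectConst]
  | succ m ih =>
    have hne : (∏ j : Fin m, (1 - q ^ ((j : ℕ) + 1))) ≠ 0 :=
      prod_ne_zero_iff.2 fun j _ => sub_ne_zero.2 (hq j).symm
    have h1 : ∏ k ∈ range m, (c * q + d * q * q ^ k) ^ (m - k) =
        q ^ (∑ k ∈ range m, (m - k)) * ∏ k ∈ range m, (c + d * q ^ k) ^ (m - k) := by
      rw [← prod_pow_eq_pow_sum, ← prod_mul_distrib]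
      refine prod_congr rfl fun k _ => ?_
      rw [← mul_pow]
      congr 1
      ring
    have h2 : ∏ k ∈ range (m + 1), (c + d * q ^ k) ^ (m + 1 - k) =
        (∏ k ∈ range (m + 1), (c + d * q ^ k)) * ∏ k ∈ range m, (c + d * q ^ k) ^ (m - k) := by
      have : ∏ k ∈ range m, (c + d * q ^ k) ^ (m - k) =
          ∏ k ∈ range (m + 1), (c + d * q ^ k) ^ (m - k) := by
        rw [prod_range_succ, Nat.sub_self, pow_zero, mul_one]
      rw [this, ← prod_mul_distrib]
      refine prod_congr rfl fun k hk => ?_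
      rw [Nat.succ_sub (Nat.lt_succ_iff.1 (mem_range.1 hk)), pow_succ']
    have h3 : ∑ k ∈ range m, (m - k) + ∑ k ∈ range m, k = m ^ 2 := by
      rw [← sum_add_distrib, sum_congr rfl (g := fun _ => m)]
      · simp [sq]
      · intro k hk
        have := mem_range.1 hk
        omega
    rw [rectConst, Nat.add_sub_cancel, det_vandermonde_pow_succ, h2, sum_range_succ, pow_add, ← h3,
      pow_add, Fin.prod_univ_eq_prod_range (fun k => c + d * q ^ k)]
    have := ih (c * q) (d * q)
    rw [h1] at this
    calc _ = (∏ k ∈ range (m + 1), (c + d * q ^ k)) * q ^ (∑ j ∈ range m, j) *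
          (rectConst q m (c * q) (d * q) *
            (Matrix.vandermonde (fun i : Fin m => q ^ (m - 1 - (i : ℕ)))).det) := by
          field_simp
      _ = _ := by
        rw [this]
        ring

theorem rectSum_image (q : ℝ) (hq0 : 0 < q) (hq1 : q ≠ 1) (n m : ℕ) (c d : ℝ) (s : Fin m → ℕ)
    (hs : StrictMono s) (hn : ∀ i, s i < n) :
    rectSum q n m c d (univ.image s) =
      q ^ (∑ k ∈ range m, k ^ 2 + ∑ i, s i) * (∏ k ∈ range m, (c + d * q ^ k) ^ (m - k)) *
        ∏ i : Fin m, ∏ j ∈ Ioi i, (q ^ s j - q ^ s i) / (q ^ (j : ℕ) - q ^ (i : ℕ)) := by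
  have hq : ∀ j : ℕ, q ^ (j + 1) ≠ 1 := fun j h =>
    hq1 ((pow_eq_one_iff_of_nonneg hq0.le j.succ_ne_zero).1 h)
  have hl : (univ.image s) = (List.ofFn (fun i => s i.rev)).toFinset := by
    ext x
    simp only [mem_image, mem_univ, true_and, List.mem_toFinset, List.mem_ofFn]
    constructor
    · rintro ⟨i, rfl⟩
      exact ⟨i.rev, by simp⟩
    · rintro ⟨i, rfl⟩
      exact ⟨i.rev, rfl⟩
  have hget : ∀ i : Fin m, (List.ofFn (fun i => s i.rev)).getD i 0 = s i.rev := by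
    intro i
    rw [List.getD_eq_getElem _ _ (by simp)]
    simp
  rw [hl, rectSum_eq q hq n m c d _ (by simp)]
  · rw [qVandermonde]
    simp_rw [hget]
    have h1 : ∏ i : Fin m, q ^ s i.rev = q ^ ∑ i, s i := by
      rw [prod_pow_eq_pow_sum]
      congr 1
      exact Equiv.sum_comp Fin.revPerm s
    have hD : (Matrix.vandermonde (fun i : Fin m => q ^ (i.rev : ℕ))).det ≠ 0 := by
      rw [Matrix.det_vandermonde_ne_zero_iff]
      intro i j hij
      exact Fin.rev_injective (Fin.ext (pow_right_injective₀ hq0 hq1 hij))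
    rw [h1, ← det_vandermonde_rev_div m (fun i => q ^ s i) (fun i => q ^ (i : ℕ)), pow_add,
      mul_right_comm _ (q ^ ∑ i, s i), ← rectConst_mul_det q hq]
    have h2 : (fun i : Fin m => q ^ (m - 1 - (i : ℕ))) = fun i => q ^ (i.rev : ℕ) := by
      funext i
      rw [Fin.val_rev]
      congr 1
      omega
    rw [h2]
    field_simp
  · rw [List.pairwise_ofFn]
    intro i j hij
    exact hs (Fin.rev_lt_rev.2 hij)
  · intro x hx
    obtain ⟨i, rfl⟩ := (List.mem_ofFn' _ _).1 hx
    exact hn _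

/-! ### Normalising a and b by vertex factors. -/

theorem prod_gauge (a b : ℝ) (ha : 0 < a) (hb : 0 < b) (n m : ℕ) (s : Fin m → ℕ)
    (hs : StrictMono s) :
    (∏ r ∈ range m ×ˢ range (n + 1), (b / a) ^ r.2) *
      (∏ p ∈ {0} ×ˢ univ.image s ∪ Icc 1 m ×ˢ range n, a * (a / b) ^ p.2) =
      b ^ (n * m) * a ^ m * (a / b) ^ ∑ i, s i := by
  rw [prod_union, prod_product, prod_product, prod_product]
  · simp only [prod_const, card_range, Nat.card_Icc, Nat.add_sub_cancel, card_singleton]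
    rw [prod_image hs.injective.injOn, prod_mul_distrib, prod_mul_distrib, prod_const, prod_const,
      card_univ, Fintype.card_fin, card_range, prod_pow_eq_pow_sum, prod_pow_eq_pow_sum,
      prod_pow_eq_pow_sum, sum_range_succ, mul_comm _ ((_ : ℝ) ^ m), ← mul_assoc, ← mul_pow]
    have : (b / a) ^ (∑ i ∈ range n, i + n) * (a ^ n * (a / b) ^ (∑ i ∈ range n, i)) = b ^ n := by
      rw [pow_add, div_pow, div_pow, div_pow]
      field_simp
    rw [this, pow_mul]
    ring
  · rw [disjoint_left]
    rintro ⟨i, j⟩ h h'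
    simp only [mem_product, mem_singleton, mem_Icc] at h h'
    omega

/-- The vertex factors multiply to a on an edge at a left corner (j = t) and to b at a right corner
(j = t + 1). They thus turn the unit upper weights into a, b and c/a, d/b into c, d. -/
theorem gauge_mul_latticeWeight (a b c d q : ℝ) (ha : 0 < a) (hb : 0 < b) (i j k t : ℕ) :
    (b / a) ^ j * (a * (a / b) ^ t) * latticeWeight (c / a) (d / b) q (i, j) (k, t) =
      if (k = i ∨ k = i + 1) ∧ (j = t ∨ j = t + 1) then
        if k = i + 1 then
          if j = t then a else b
        else
          if j = t then c * q ^ (i + t) else d * q ^ (i + t)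
      else 0 := by
  simp only [latticeWeight, topWeight, bottomWeight]
  have e1 : ∀ k : ℕ, (b / a) ^ k * (a * (a / b) ^ k) = a := by
    intro k
    rw [div_pow, div_pow]
    field_simp
  have e2 : ∀ k : ℕ, (b / a) ^ (k + 1) * (a * (a / b) ^ k) = b := by
    intro k
    rw [div_pow, div_pow, pow_succ b, pow_succ a]
    field_simp
  by_cases h1 : k = i + 1
  · subst h1
    by_cases h2 : j = t
    · subst h2
      simp [e1]
    · by_cases h3 : j = t + 1
      · subst h3
        simp [e2]
      · have h3' : t + 1 ≠ j := fun h => h3 h.symm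
        have h2' : t ≠ j := fun h => h2 h.symm
        simp [h2, h3, h2', h3']
  · by_cases h4 : k = i
    · subst h4
      by_cases h2 : j = t
      · subst h2
        simp only [e1]
        simp
        field_simp
      · by_cases h3 : j = t + 1
        · subst h3
          simp only [e2]
          simp
          field_simp
        · simp [h2, h3]
    · simp [h1, h4]

open AztecRectangle in
theorem holeyGF_eq (a b c d q : ℝ) (ha : 0 < a) (hb : 0 < b) (n m : ℕ) (s : Fin m → ℕ)
    (hs : StrictMono s) (hn : ∀ i, s i < n) :
    holeyGF a b c d q n (fun i => s i + 1) =
      b ^ (n * m) * a ^ m * (a / b) ^ (∑ i, s i) *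
        rectSum q n m (c / a) (d / b) (univ.image s) := by
  classical
  rw [← prod_gauge a b ha hb n m s hs, rectSum, ← perm_mul_mul, holeyGF]
  let X : Finset (kept n (fun i => s i + 1)) := univ.filter (fun v => v.1.isRight)
  let f : kept n (fun i => s i + 1) → ℕ × ℕ := fun v =>
    Sum.elim (fun p => ((p.1 : ℕ), (p.2 : ℕ))) (fun r => ((r.1 : ℕ), (r.2 : ℕ))) v.1
  have hX : X.image f = range m ×ˢ range (n + 1) := by
    ext ⟨i, j⟩
    simp only [mem_image, mem_product, mem_range, X, f, mem_filter, mem_univ, true_and]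
    constructor
    · rintro ⟨⟨p | r, hv⟩, h, he⟩
      · simp at h
      · simp only [Sum.elim_inr, Prod.mk.injEq] at he
        omega
    · rintro ⟨hi, hj⟩
      exact ⟨⟨Sum.inr (⟨i, hi⟩, ⟨j, hj⟩), fun _ h => by simp at h⟩, rfl, rfl⟩
  have hXc : Xᶜ.image f = {0} ×ˢ univ.image s ∪ Icc 1 m ×ˢ range n := by
    ext ⟨i, j⟩
    simp only [mem_image, mem_product, mem_range, X, f, mem_filter, mem_univ, true_and, mem_compl,
      mem_union, mem_singleton, mem_Icc]
    constructor
    · rintro ⟨⟨⟨i', j'⟩ | r, hv⟩, h, he⟩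
      · simp only [Sum.elim_inl, Prod.mk.injEq] at he
        obtain ⟨rfl, rfl⟩ := he
        by_cases h0 : (i' : ℕ) = 0
        · left
          have : i' = 0 := Fin.ext h0
          subst this
          obtain ⟨k, hk⟩ := hv j' rfl
          exact ⟨rfl, k, by simpa using hk⟩
        · right
          omega
      · simp at h
    · rintro (⟨rfl, k, rfl⟩ | ⟨⟨h1, h2⟩, h3⟩)
      · refine ⟨⟨Sum.inl (0, ⟨s k, hn k⟩), ?_⟩, by simp, rfl⟩
        intro j hj
        simp only [Sum.inl.injEq, Prod.mk.injEq, true_and] at hj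
        exact ⟨k, by rw [← hj]⟩
      · refine ⟨⟨Sum.inl (⟨i, by omega⟩, ⟨j, h3⟩), ?_⟩, by simp, rfl⟩
        intro j hj
        simp only [Sum.inl.injEq, Prod.mk.injEq] at hj
        have := congrArg Fin.val hj.1
        simp at this
        omega
  rw [matchingGF_eq_perm _ _ X, ← hX, ← hXc]
  · symm
    refine perm_image ?_ ?_ ?_
    · rintro ⟨p | ⟨r1, r2⟩, hv⟩ h ⟨p' | ⟨r1', r2'⟩, hv'⟩ h' he
      · simp [X] at h
      · simp [X] at h
      · simp [X] at h'
      · simp only [f, Sum.elim_inr, Prod.mk.injEq] at he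
        simp [Fin.ext_iff, he]
    · rintro ⟨⟨p1, p2⟩ | r, hv⟩ h ⟨⟨p1', p2'⟩ | r', hv'⟩ h' he
      · simp only [f, Sum.elim_inl, Prod.mk.injEq] at he
        simp [Fin.ext_iff, he]
      · simp [X] at h'
      · simp [X] at h
      · simp [X] at h
    · rintro ⟨p | ⟨r1, r2⟩, hv⟩ h ⟨⟨p1, p2⟩ | r', hv'⟩ h'
      · simp [X] at h
      · simp [X] at h
      · have hadj : ((graph m n).induce (kept n (fun i => s i + 1))).Adj
            ⟨Sum.inr (r1, r2), hv⟩ ⟨Sum.inl (p1, p2), hv'⟩ ↔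
            (((p1 : ℕ) = r1 ∨ (p1 : ℕ) = r1 + 1) ∧ ((r2 : ℕ) = p2 ∨ (r2 : ℕ) = p2 + 1)) :=
          Iff.rfl
        have hw : weight a b c d q m n (Sym2.map Subtype.val
            s((⟨Sum.inr (r1, r2), hv⟩ : kept n (fun i => s i + 1)), ⟨Sum.inl (p1, p2), hv'⟩)) =
            sideWeight a b c d q (p1, p2) (r1, r2) := rfl
        exact (gauge_mul_latticeWeight a b c d q ha hb r1 r2 p1 p2).trans
          (if_congr hadj hw rfl).symm
      · simp [X] at h'
  · rintro ⟨p | r, hv⟩ ⟨p' | r', hv'⟩ h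
    · exact absurd h (by simp [graph])
    · simp [X]
    · simp [X]
    · exact absurd h (by simp [graph])

/-! ### Continuity in q, exponent bookkeeping and the final formulas. -/

theorem continuous_holeyGF (a b c d : ℝ) (n m : ℕ) (s : Fin m → ℕ) :
    Continuous (fun q => AztecRectangle.holeyGF a b c d q n s) := by
  classical
  unfold AztecRectangle.holeyGF AztecRectangle.matchingGF
  refine continuous_finsetSum _ fun M _ => continuous_finsetProd _ fun e _ => ?_
  have hside : ∀ (p : Fin (m + 1) × Fin n) (r : Fin m × Fin (n + 1)),
      Continuous (fun q => AztecRectangle.sideWeight a b c d q p r) := by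
    intro p r
    unfold AztecRectangle.sideWeight
    split_ifs <;> fun_prop
  induction e using Sym2.ind with
  | _ u v =>
    obtain ⟨p | r, hu⟩ := u <;> obtain ⟨p' | r', hv⟩ := v
    · exact continuous_const
    · exact hside p r'
    · exact hside p' r
    · exact continuous_const

/-- Makes the division by 3 in the exponent of q exact: Σ k² comes from the constant factor, and Σ k
from measuring positions by s_i - i. -/
theorem three_mul_sum_sq_add (m : ℕ) :
    3 * ((∑ k ∈ range m, k ^ 2 : ℕ) + (∑ k ∈ range m, k : ℕ) : ℤ) =
      ((m : ℤ) - 1) * m * (m + 1) := by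
  induction m with
  | zero => simp
  | succ m ih =>
    rw [sum_range_succ, sum_range_succ]
    push_cast at ih ⊢
    linear_combination ih

theorem two_mul_sum_range (m : ℕ) : 2 * ((∑ k ∈ range m, k : ℕ) : ℤ) = (m : ℤ) * (m - 1) := by
  induction m with
  | zero => simp
  | succ m ih =>
    rw [sum_range_succ]
    push_cast at ih ⊢
    linear_combination ih

theorem sum_range_sub (m : ℕ) : ((∑ k ∈ range m, (m - k) : ℕ) : ℤ) = (∑ k ∈ range m, k : ℕ) + m := by
  induction m with
  | zero => simp
  | succ m ih =>
    have : ∑ k ∈ range m, (m + 1 - k) = ∑ k ∈ range m, (m - k) + m := by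
      rw [sum_congr rfl (g := fun k => m - k + 1), sum_add_distrib]
      · simp
      · intro k hk
        have := mem_range.1 hk
        omega
    rw [sum_range_succ, this, sum_range_succ]
    have e : m + 1 - m = 1 := by omega
    rw [e]
    push_cast at ih ⊢
    linear_combination ih

theorem prod_Icc_eq_prod_range (a b c d q : ℝ) (ha : 0 < a) (hb : 0 < b) (m : ℕ) :
    ∏ k ∈ Icc 1 m, (a * d * q ^ (k - 1) + b * c) ^ (m - k + 1) =
      (a * b) ^ (∑ k ∈ range m, (m - k)) *
        ∏ k ∈ range m, (c / a + d / b * q ^ k) ^ (m - k) := by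
  rw [← prod_pow_eq_pow_sum, ← prod_mul_distrib, ← Ico_add_one_right_eq_Icc,
    prod_Ico_eq_prod_range]
  refine prod_congr (by simp) fun k hk => ?_
  have hk' : k < m := by simpa using hk
  rw [← mul_pow]
  have e : m - (1 + k) + 1 = m - k := by omega
  rw [e, Nat.add_sub_cancel_left]
  congr 1
  field_simp
  ring

theorem sum_sub_succ (m : ℕ) (s : Fin m → ℕ) :
    ∑ i : Fin m, (((s i + 1 : ℕ) : ℤ) - ((i : ℤ) + 1)) =
      (∑ i, s i : ℕ) - (∑ k ∈ range m, k : ℕ) := by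
  rw [← Fin.sum_univ_eq_sum_range (fun k => k)]
  push_cast
  rw [← sum_sub_distrib]
  exact sum_congr rfl fun i _ => by ring

/-- The power of ab split off here clears the denominators in the factors c/a + (d/b) q^k. -/
theorem gauge_prefactor (a b : ℝ) (ha : 0 < a) (hb : 0 < b) (m n σ : ℕ) :
    b ^ (n * m) * a ^ m * (a / b) ^ σ =
      a ^ ((σ : ℤ) - (∑ k ∈ range m, k : ℕ)) *
        b ^ ((m : ℤ) * ((n : ℤ) - m) - ((σ : ℤ) - (∑ k ∈ range m, k : ℕ))) *
        (a * b) ^ (∑ k ∈ range m, (m - k)) := by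
  have h1 := two_mul_sum_range m
  have h2 := sum_range_sub m
  have ha' := ha.ne'
  have hb' := hb.ne'
  rw [mul_pow, div_pow, ← zpow_natCast b (n * m), ← zpow_natCast a m, ← zpow_natCast a σ,
    ← zpow_natCast b σ, ← zpow_natCast a (∑ k ∈ range m, (m - k)),
    ← zpow_natCast b (∑ k ∈ range m, (m - k)), h2]
  calc _ = (a ^ (m : ℤ) * a ^ (σ : ℤ)) * (b ^ ((n * m : ℕ) : ℤ) / b ^ (σ : ℤ)) := by ring
    _ = a ^ ((σ : ℤ) - (∑ k ∈ range m, k : ℕ) + ((∑ k ∈ range m, k : ℕ) + m)) *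
        b ^ ((m : ℤ) * ((n : ℤ) - m) - ((σ : ℤ) - (∑ k ∈ range m, k : ℕ)) +
          ((∑ k ∈ range m, k : ℕ) + m)) := by
      rw [← zpow_add₀ ha', ← zpow_sub₀ hb']
      congr 2
      · ring
      · push_cast at h1 ⊢
        linear_combination -h1
    _ = _ := by
      rw [zpow_add₀ ha', zpow_add₀ hb']
      ring

theorem holeyGF_of_ne_one (a b c d q : ℝ) (ha : 0 < a) (hb : 0 < b) (hq : 0 < q) (hq1 : q ≠ 1)
    (m n : ℕ) (s : Fin m → ℕ) (hs : StrictMono s) (hs1 : ∀ i, 1 ≤ s i) (hsn : ∀ i, s i ≤ n) :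
    AztecRectangle.holeyGF a b c d q n s =
      q ^ (((m : ℤ) - 1) * m * (m + 1) / 3 + ∑ i : Fin m, ((s i : ℤ) - ((i : ℤ) + 1)))
        * a ^ (∑ i : Fin m, ((s i : ℤ) - ((i : ℤ) + 1)))
        * b ^ ((m : ℤ) * ((n : ℤ) - m) - ∑ i : Fin m, ((s i : ℤ) - ((i : ℤ) + 1)))
        * (∏ k ∈ Icc 1 m, (a * d * q ^ (k - 1) + b * c) ^ (m - k + 1))
        * ∏ i : Fin m, ∏ j ∈ Ioi i,
            (q ^ s j - q ^ s i) / (q ^ ((j : ℕ) + 1) - q ^ ((i : ℕ) + 1)) := by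
  obtain ⟨t, rfl⟩ : ∃ t : Fin m → ℕ, s = fun i => t i + 1 :=
    ⟨fun i => s i - 1, funext fun i => (Nat.sub_add_cancel (hs1 i)).symm⟩
  have ht : StrictMono t := fun i j hij => Nat.lt_of_add_lt_add_right (hs hij)
  rw [holeyGF_eq a b c d q ha hb n m t ht hsn, rectSum_image q hq hq1 n m _ _ t ht hsn,
    sum_sub_succ, prod_Icc_eq_prod_range a b c d q ha hb, gauge_prefactor a b ha hb]
  have hquot : ∀ i j : Fin m, (q ^ (t j + 1) - q ^ (t i + 1)) /
      (q ^ ((j : ℕ) + 1) - q ^ ((i : ℕ) + 1)) =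
      (q ^ t j - q ^ t i) / (q ^ (j : ℕ) - q ^ (i : ℕ)) := by
    intro i j
    simp_rw [pow_succ, ← sub_mul]
    exact mul_div_mul_right _ _ hq.ne'
  simp_rw [hquot]
  have he : q ^ (((m : ℤ) - 1) * m * (m + 1) / 3 +
      ((∑ i, t i : ℕ) - (∑ k ∈ range m, k : ℕ) : ℤ)) =
      q ^ (∑ k ∈ range m, k ^ 2 + ∑ i, t i) := by
    rw [← three_mul_sum_sq_add, Int.mul_ediv_cancel_left _ (by norm_num), ← zpow_natCast]
    congr 1
    push_cast
    ring
  rw [he]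
  ring

theorem prod_Icc_pow (x : ℝ) (m : ℕ) : ∏ k ∈ Icc 1 m, x ^ (m - k + 1) = x ^ (m * (m + 1) / 2) := by
  rw [prod_pow_eq_pow_sum]
  congr 1
  have h : ∑ k ∈ Icc 1 m, (m - k + 1) = ∑ k ∈ range m, (m - k) := by
    rw [← Ico_add_one_right_eq_Icc, sum_Ico_eq_sum_range]
    refine sum_congr (by simp) fun k hk => ?_
    have : k < m := by simpa using hk
    omega
  have h1 := two_mul_sum_range m
  have h2 := sum_range_sub m
  have h3 : 2 * (∑ k ∈ range m, (m - k)) = m * (m + 1) := by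
    zify
    push_cast at h1 h2
    rw [h2]
    linear_combination h1
  rw [h, ← h3, Nat.mul_div_cancel_left _ two_pos]

theorem holeyGF_one (a b c d : ℝ) (ha : 0 < a) (hb : 0 < b)
    (m n : ℕ) (s : Fin m → ℕ) (hs : StrictMono s) (hs1 : ∀ i, 1 ≤ s i) (hsn : ∀ i, s i ≤ n) :
    AztecRectangle.holeyGF a b c d 1 n s =
      a ^ (∑ i : Fin m, ((s i : ℤ) - ((i : ℤ) + 1)))
        * b ^ ((m : ℤ) * ((n : ℤ) - m) - ∑ i : Fin m, ((s i : ℤ) - ((i : ℤ) + 1)))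
        * (a * d + b * c) ^ (m * (m + 1) / 2)
        * ∏ i : Fin m, ∏ j ∈ Ioi i, ((s j : ℝ) - (s i : ℝ)) / ((j : ℝ) - (i : ℝ)) := by
  -- The formula for q ≠ 1 with q - 1 cancelled from every quotient. It is continuous at 1 and
  -- agrees with the generating function at positive q ≠ 1, so the two limits at 1 coincide.
  let g : ℝ → ℝ := fun q =>
    q ^ (((m : ℤ) - 1) * m * (m + 1) / 3 + ∑ i : Fin m, ((s i : ℤ) - ((i : ℤ) + 1)))
        * a ^ (∑ i : Fin m, ((s i : ℤ) - ((i : ℤ) + 1)))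
        * b ^ ((m : ℤ) * ((n : ℤ) - m) - ∑ i : Fin m, ((s i : ℤ) - ((i : ℤ) + 1)))
        * (∏ k ∈ Icc 1 m, (a * d * q ^ (k - 1) + b * c) ^ (m - k + 1))
        * ∏ i : Fin m, ∏ j ∈ Ioi i,
            (∑ t ∈ Ico (s i) (s j), q ^ t) / (∑ t ∈ Ico ((i : ℕ) + 1) ((j : ℕ) + 1), q ^ t)
  have hden : ∀ i j : Fin m, i < j →
      (∑ t ∈ Ico ((i : ℕ) + 1) ((j : ℕ) + 1), (1 : ℝ) ^ t) = (j : ℝ) - i := by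
    intro i j hij
    have : (i : ℕ) ≤ j := hij.le
    simp [Nat.cast_sub this]
  have hnum : ∀ i j : Fin m, i < j →
      (∑ t ∈ Ico (s i) (s j), (1 : ℝ) ^ t) = (s j : ℝ) - s i := by
    intro i j hij
    simp [Nat.cast_sub (hs hij).le]
  have hne : ∀ i j : Fin m, i < j → (j : ℝ) - (i : ℝ) ≠ 0 := by
    intro i j hij
    have : (i : ℝ) < j := by exact_mod_cast hij
    linarith
  have hg : ContinuousAt g 1 := by
    refine ContinuousAt.mul (ContinuousAt.mul (ContinuousAt.mul (ContinuousAt.mul ?_ ?_) ?_) ?_) ?_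
    · exact continuousAt_zpow₀ _ _ (Or.inl one_ne_zero)
    · exact continuousAt_const
    · exact continuousAt_const
    · exact Continuous.continuousAt (by fun_prop)
    · refine tendsto_finsetProd _ fun i _ => tendsto_finsetProd _ fun j hj => ?_
      have hij := mem_Ioi.1 hj
      refine ContinuousAt.div ?_ ?_ ?_
      · exact Continuous.continuousAt (by fun_prop)
      · exact Continuous.continuousAt (by fun_prop)
      · rw [hden i j hij]
        exact hne i j hij
  have hg1 : g 1 = a ^ (∑ i : Fin m, ((s i : ℤ) - ((i : ℤ) + 1)))
        * b ^ ((m : ℤ) * ((n : ℤ) - m) - ∑ i : Fin m, ((s i : ℤ) - ((i : ℤ) + 1)))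
        * (a * d + b * c) ^ (m * (m + 1) / 2)
        * ∏ i : Fin m, ∏ j ∈ Ioi i, ((s j : ℝ) - (s i : ℝ)) / ((j : ℝ) - (i : ℝ)) := by
    rw [← prod_Icc_pow]
    have : ∀ i : Fin m, ∏ j ∈ Ioi i, ((s j : ℝ) - (s i : ℝ)) / ((j : ℝ) - (i : ℝ)) =
        ∏ j ∈ Ioi i, (∑ t ∈ Ico (s i) (s j), (1 : ℝ) ^ t) /
          (∑ t ∈ Ico ((i : ℕ) + 1) ((j : ℕ) + 1), (1 : ℝ) ^ t) := fun i =>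
      prod_congr rfl fun j hj => by rw [hnum i j (mem_Ioi.1 hj), hden i j (mem_Ioi.1 hj)]
    simp_rw [this]
    simp only [g, one_zpow, one_pow, one_mul, mul_one]
  have heq : ∀ q : ℝ, 0 < q → q ≠ 1 → AztecRectangle.holeyGF a b c d q n s = g q := by
    intro q hq hq1
    rw [holeyGF_of_ne_one a b c d q ha hb hq hq1 m n s hs hs1 hsn]
    simp only [g]
    congr 1
    refine prod_congr rfl fun i _ => prod_congr rfl fun j hj => ?_
    have hij := mem_Ioi.1 hj
    have hij' : (i : ℕ) + 1 ≤ (j : ℕ) + 1 := Nat.succ_le_succ hij.le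
    rw [← geom_sum_Ico_mul q (hs hij).le, ← geom_sum_Ico_mul q hij',
      mul_div_mul_right _ _ (sub_ne_zero.2 hq1)]
  rw [← hg1]
  refine tendsto_nhds_unique (f := fun q => AztecRectangle.holeyGF a b c d q n s)
    (l := nhdsWithin 1 {1}ᶜ) ?_ ?_
  · exact ((continuous_holeyGF a b c d n m s).tendsto 1).mono_left nhdsWithin_le_nhds
  · refine (hg.tendsto.mono_left nhdsWithin_le_nhds).congr' ?_
    filter_upwards [self_mem_nhdsWithin,
      mem_nhdsWithin_of_mem_nhds (lt_mem_nhds (zero_lt_one' ℝ))] with q h1 h0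
    exact (heq q h0 h1).symm

end BipartiteSum

theorem theorem3p1 (m n : ℕ) (hm : 0 < m) (hmn : m < n)
    (a b c d q : ℝ) (ha : 0 < a) (hb : 0 < b) (hc : 0 < c) (hd : 0 < d) (hq : 0 < q)
    (s : Fin m → ℕ) (hs : StrictMono s) (hs1 : ∀ i, 1 ≤ s i) (hsn : ∀ i, s i ≤ n) :
    (q ≠ 1 →
      AztecRectangle.holeyGF a b c d q n s =
        q ^ (((m : ℤ) - 1) * m * (m + 1) / 3 + ∑ i : Fin m, ((s i : ℤ) - ((i : ℤ) + 1)))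
        * a ^ (∑ i : Fin m, ((s i : ℤ) - ((i : ℤ) + 1)))
        * b ^ ((m : ℤ) * ((n : ℤ) - m) - ∑ i : Fin m, ((s i : ℤ) - ((i : ℤ) + 1)))
        * (∏ k ∈ Finset.Icc 1 m, (a * d * q ^ (k - 1) + b * c) ^ (m - k + 1))
        * ∏ i : Fin m, ∏ j ∈ Finset.Ioi i,
            (q ^ s j - q ^ s i) / (q ^ ((j : ℕ) + 1) - q ^ ((i : ℕ) + 1))) ∧
    (q = 1 →
      AztecRectangle.holeyGF a b c d q n s =
        a ^ (∑ i : Fin m, ((s i : ℤ) - ((i : ℤ) + 1)))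
        * b ^ ((m : ℤ) * ((n : ℤ) - m) - ∑ i : Fin m, ((s i : ℤ) - ((i : ℤ) + 1)))
        * (a * d + b * c) ^ (m * (m + 1) / 2)
        * ∏ i : Fin m, ∏ j ∈ Finset.Ioi i,
            ((s j : ℝ) - (s i : ℝ)) / ((j : ℝ) - (i : ℝ))) := by
  refine ⟨fun hq1 => ?_, ?_⟩
  · exact BipartiteSum.holeyGF_of_ne_one a b c d q ha hb hq hq1 m n s hs hs1 hsn
  · rintro rfl
    exact BipartiteSum.holeyGF_one a b c d ha hb m n s hs hs1 hsn
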